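/- A dynamic flow network (continuous time) consists of a finite set $V$ of vertices with a source $s$ and a target $t\neq s$, a set $E\subseteq V\times V$ of directed edges, a time horizon $T\ge 0$, and for every $e\in E$ a transit time $\tau_e\ge 0$ and a capacity $u_e:[0,T]\to\mathbb R_{\ge 0}$ that is continuous except at finitely many points. A dynamic flow $f$ assigns to each $e\in E$ a measurable function $f_e$ on $[0,T-\tau_e]$ with $0\le f_e(\theta)\le u_e(\theta)$, extended by $0$ to all other times, such that $\mathrm{ex}_f(v,\theta)=0$ for all $v\in V\setminus\{s,t\}$ and $\theta\in[0,T]$, where $$\mathrm{ex}_f(v,\theta)=\int_0^\theta\Big(\sum_{e=(w,v)\in E}f_e(\zeta-\tau_e)-\sum_{e=(v,w)\in E}f_e(\zeta)\Big)\,d\zeta .$$ A maximum flow is a dynamic flow of maximum value $\mathrm{ex}_f(t,T)$. A dynamic cut $S$ assigns to each $v\in V$ a measurable function $S_v$ with values in $\{0,1\}$ such that $S_s=1$ and $S_t=0$ on $[0,T]$, and $S_v(\theta)=1$ for all $v\in V$ and $\theta>T$. A minimum cut is a dynamic cut of minimum capacity $$\mathrm{cap}(S)=\int_0^T\ \sum_{e=(v,w)\in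 E,\ S_v(\theta)=1,\ S_w(\theta+\tau_e)=0}u_e(\theta)\,d\theta .$$ A function $g$ on an interval $[0,D]$ changes at $\theta\in(0,D)$ if $g(\theta-\varepsilon)\ne g(\theta+\varepsilon)$ for all sufficiently small $\varepsilon>0$. The complexity of a cut is the total number of changes of all $S_v$ on $[0,T]$, the complexity of a flow is the total number of changes of all $f_e$ on $[0,T-\tau_e]$, and the number of capacity changes of the network is the total number of changes of all $u_e$ on $[0,T]$. A flow or cut is called piecewise constant if each $f_e$ (on $[0,T-\tau_e]$), respectively each $S_v$ (on $[0,T]$), is constant on each of the finitely many intervals that are left when a suitable finite set of points is removed from its domain. In discrete time, the times are the integers, $T$ and the $\tau_e$ are nonnegative integers, $[0,T]$ is replaced by $\{0,1,\dots,T\}$, integrals over $[0,\theta]$ are replaced by sums over $\{0,\dots,\theta\}$, the continuity, measurability and piecewise constancy conditions are dropped, and a function on $\{0,\dots,D\}$ changes at $\theta\in\{1,\dots,D\}$ if $g(\theta-1)\neq g(\theta)$. The size of a network with step functions as capacities, in which all capacities are rational and all times are rational (integral in discrete time), is the number of vertices and edges plus the total bit length of $T$, of all transit times, of all capacity values and of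 all times of capacity changes. **Theorem.** There is a polynomial $p$ such that for every $\ell\in\mathbb N$ there is an acyclic dynamic flow network with step functions as capacities and with rational data, of size at most $p(\ell)$, with exactly one capacity change, such that a piecewise constant minimum cut and a piecewise constant maximum flow exist, every piecewise constant minimum cut has complexity at least $2^\ell$, and every piecewise constant maximum flow has complexity at least $2^\ell$. The same holds in discrete time: there is a polynomial $q$ such that for every $\ell\in\mathbb N$ there is an acyclic discrete-time dynamic flow network with step functions as capacities, rational capacity values and integral times, of size at most $q(\ell)$, with exactly one capacity change, which has a minimum cut and a maximum flow, and in which every minimum cut and every maximum flow has complexity at least $2^\ell$. -/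

import Mathlib

open Set Filter Topology

/-! ### Dynamic networks, over a time domain `𝕋` (`ℝ` for continuous, `ℤ` for discrete time) -/

/-- A dynamic flow network on the vertex set `V`: directed edges, time-dependent nonnegative
capacities that are continuous on `[0, T]` outside finitely many points (no restriction in discrete
time), nonnegative transit times, and a time horizon `T`. -/
structure DynamicNetwork (𝕋 V : Type*) [Zero 𝕋] [Preorder 𝕋] [TopologicalSpace 𝕋] where
  source : V
  sink : V
  source_ne_sink : source ≠ sink
  edges : Finset (V × V)
  cap : V × V → 𝕋 → ℝ
  transit : V × V → 𝕋
  horizon : 𝕋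
  horizon_nonneg : 0 ≤ horizon
  transit_nonneg : ∀ e ∈ edges, 0 ≤ transit e
  cap_nonneg : ∀ e ∈ edges, ∀ θ ∈ Icc 0 horizon, 0 ≤ cap e θ
  cap_continuousOn : ∀ e ∈ edges, ∃ F : Set 𝕋, F.Finite ∧
    ContinuousOn (cap e) (Icc 0 horizon \ F)

namespace DynamicNetwork

section Common

variable {𝕋 V : Type*} [AddCommGroup 𝕋] [LinearOrder 𝕋] [TopologicalSpace 𝕋]

/-- There is no directed cycle. -/
def IsAcyclic (N : DynamicNetwork 𝕋 V) : Prop :=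
  ∀ v, ¬ Relation.TransGen (fun a b => (a, b) ∈ N.edges) v v

/-- Flow arriving at `v` at time `ζ` minus flow leaving `v` at time `ζ`; `f e ζ` is the flow that
enters the edge `e` at time `ζ`. -/
def netInflow [DecidableEq V] (N : DynamicNetwork 𝕋 V) (f : V × V → 𝕋 → ℝ) (v : V) (ζ : 𝕋) : ℝ :=
  (∑ e ∈ N.edges with e.2 = v, f e (ζ - N.transit e)) - ∑ e ∈ N.edges with e.1 = v, f e ζ

/-- The capacity constraints `0 ≤ f_e ≤ u_e` on `[0, T - τ_e]`, together with the convention that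
`f_e` vanishes outside `[0, T - τ_e]`. -/
structure IsCapacityFeasible (N : DynamicNetwork 𝕋 V) (f : V × V → 𝕋 → ℝ) : Prop where
  eq_zero : ∀ e ∈ N.edges, ∀ θ, θ ∉ Icc 0 (N.horizon - N.transit e) → f e θ = 0
  nonneg : ∀ e ∈ N.edges, ∀ θ ∈ Icc 0 (N.horizon - N.transit e), 0 ≤ f e θ
  le_cap : ∀ e ∈ N.edges, ∀ θ ∈ Icc 0 (N.horizon - N.transit e), f e θ ≤ N.cap e θ

/-- `S v θ = true` says that `v` lies in the source part at time `θ`. The source always does and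
the sink never does during `[0, T]`; by convention every vertex does after time `T`. -/
structure IsCut (N : DynamicNetwork 𝕋 V) (S : V → 𝕋 → Bool) : Prop where
  source_mem : ∀ θ ∈ Icc 0 N.horizon, S N.source θ = true
  sink_notMem : ∀ θ ∈ Icc 0 N.horizon, S N.sink θ = false
  after_horizon : ∀ v, ∀ θ, N.horizon < θ → S v θ = true

/-- Total capacity of the edges that contribute to the cut `S` at time `θ`. -/
def cutRate (N : DynamicNetwork 𝕋 V) (S : V → 𝕋 → Bool) (θ : 𝕋) : ℝ :=
  ∑ e ∈ N.edges with S e.1 θ = true ∧ S e.2 (θ + N.transit e) = false, N.cap e θ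

end Common

end DynamicNetwork

/-! ### Changes and piecewise constant functions -/

/-- Number of points `θ` in the interior of `[0, D]` at which `g` changes: `g (θ - ε) ≠ g (θ + ε)`
for every sufficiently small `ε > 0`. -/
noncomputable def contChanges {α : Type*} (g : ℝ → α) (D : ℝ) : ℕ∞ :=
  {θ : ℝ | θ ∈ Ioo 0 D ∧ ∀ᶠ ε in 𝓝[>] (0 : ℝ), g (θ - ε) ≠ g (θ + ε)}.encard

/-- Number of consecutive time steps of `{0, …, D}` between which `g` changes. -/
noncomputable def discChanges {α : Type*} (g : ℤ → α) (D : ℤ) : ℕ∞ :=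
  {θ : ℤ | θ ∈ Ioc 0 D ∧ g (θ - 1) ≠ g θ}.encard

/-- `g` is constant on each interval that is left when a suitable finite set of points is removed
from `[0, D]`. -/
def IsPiecewiseConstant {α : Type*} (g : ℝ → α) (D : ℝ) : Prop :=
  ∃ F : Set ℝ, F.Finite ∧
    ∀ x y, 0 ≤ x → x ≤ y → y ≤ D → Disjoint (Icc x y) F → g x = g y

namespace DynamicNetwork

variable {V : Type*}

/-! ### Continuous time -/

section Continuous

/-- The excess of `v` at time `θ`. -/
noncomputable def contExcess [DecidableEq V] (N : DynamicNetwork ℝ V) (f : V × V → ℝ → ℝ) (v : V)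
    (θ : ℝ) : ℝ :=
  ∫ ζ in (0 : ℝ)..θ, N.netInflow f v ζ

/-- Dynamic flows in continuous time, with strong flow conservation. -/
structure IsContFlow [DecidableEq V] (N : DynamicNetwork ℝ V) (f : V × V → ℝ → ℝ) : Prop where
  measurable : ∀ e ∈ N.edges, Measurable (f e)
  feasible : N.IsCapacityFeasible f
  conservation : ∀ v, v ≠ N.source → v ≠ N.sink → ∀ θ ∈ Icc 0 N.horizon, N.contExcess f v θ = 0

noncomputable def contFlowValue [DecidableEq V] (N : DynamicNetwork ℝ V) (f : V × V → ℝ → ℝ) : ℝ :=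
  N.contExcess f N.sink N.horizon

/-- `f` has maximum value among all dynamic flows. -/
def IsContMaxFlow [DecidableEq V] (N : DynamicNetwork ℝ V) (f : V × V → ℝ → ℝ) : Prop :=
  N.IsContFlow f ∧ ∀ f', N.IsContFlow f' → N.contFlowValue f' ≤ N.contFlowValue f

def IsPiecewiseConstantFlow (N : DynamicNetwork ℝ V) (f : V × V → ℝ → ℝ) : Prop :=
  ∀ e ∈ N.edges, IsPiecewiseConstant (f e) (N.horizon - N.transit e)

/-- Total number of changes of the functions `f_e`, each on its domain `[0, T - τ_e]`. -/
noncomputable def contFlowComplexity (N : DynamicNetwork ℝ V) (f : V × V → ℝ → ℝ) : ℕ∞ :=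
  ∑ e ∈ N.edges, contChanges (f e) (N.horizon - N.transit e)

/-- Dynamic cuts in continuous time. -/
def IsContCut (N : DynamicNetwork ℝ V) (S : V → ℝ → Bool) : Prop :=
  N.IsCut S ∧ ∀ v, Measurable (S v)

noncomputable def contCutCapacity (N : DynamicNetwork ℝ V) (S : V → ℝ → Bool) : ℝ :=
  ∫ θ in (0 : ℝ)..N.horizon, N.cutRate S θ

/-- `S` has minimum capacity among all dynamic cuts. -/
def IsContMinCut (N : DynamicNetwork ℝ V) (S : V → ℝ → Bool) : Prop :=
  N.IsContCut S ∧ ∀ S', N.IsContCut S' → N.contCutCapacity S ≤ N.contCutCapacity S'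

def IsPiecewiseConstantCut (N : DynamicNetwork ℝ V) (S : V → ℝ → Bool) : Prop :=
  ∀ v, IsPiecewiseConstant (S v) N.horizon

/-- Total number of partition changes of all vertices. -/
noncomputable def contCutComplexity [Fintype V] (N : DynamicNetwork ℝ V) (S : V → ℝ → Bool) : ℕ∞ :=
  ∑ v, contChanges (S v) N.horizon

/-- Total number of changes of the edge capacities. -/
noncomputable def contCapacityChanges (N : DynamicNetwork ℝ V) : ℕ∞ :=
  ∑ e ∈ N.edges, contChanges (N.cap e) N.horizon

end Continuous

/-! ### Discrete time: the time steps are `0, 1, …, T` -/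

section Discrete

/-- The excess of `v` after time step `θ`. -/
noncomputable def discExcess [DecidableEq V] (N : DynamicNetwork ℤ V) (f : V × V → ℤ → ℝ) (v : V) (θ : ℤ) : ℝ :=
  ∑ ζ ∈ Finset.Icc 0 θ, N.netInflow f v ζ

structure IsDiscFlow [DecidableEq V] (N : DynamicNetwork ℤ V) (f : V × V → ℤ → ℝ) : Prop where
  feasible : N.IsCapacityFeasible f
  conservation : ∀ v, v ≠ N.source → v ≠ N.sink → ∀ θ ∈ Icc 0 N.horizon, N.discExcess f v θ = 0

noncomputable def discFlowValue [DecidableEq V] (N : DynamicNetwork ℤ V) (f : V × V → ℤ → ℝ) : ℝ :=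
  N.discExcess f N.sink N.horizon

def IsDiscMaxFlow [DecidableEq V] (N : DynamicNetwork ℤ V) (f : V × V → ℤ → ℝ) : Prop :=
  N.IsDiscFlow f ∧ ∀ f', N.IsDiscFlow f' → N.discFlowValue f' ≤ N.discFlowValue f

noncomputable def discFlowComplexity (N : DynamicNetwork ℤ V) (f : V × V → ℤ → ℝ) : ℕ∞ :=
  ∑ e ∈ N.edges, discChanges (f e) (N.horizon - N.transit e)

noncomputable def discCutCapacity (N : DynamicNetwork ℤ V) (S : V → ℤ → Bool) : ℝ :=
  ∑ θ ∈ Finset.Icc 0 N.horizon, N.cutRate S θ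

def IsDiscMinCut (N : DynamicNetwork ℤ V) (S : V → ℤ → Bool) : Prop :=
  N.IsCut S ∧ ∀ S', N.IsCut S' → N.discCutCapacity S ≤ N.discCutCapacity S'

noncomputable def discCutComplexity [Fintype V] (N : DynamicNetwork ℤ V) (S : V → ℤ → Bool) : ℕ∞ :=
  ∑ v, discChanges (S v) N.horizon

noncomputable def discCapacityChanges (N : DynamicNetwork ℤ V) : ℕ∞ :=
  ∑ e ∈ N.edges, discChanges (N.cap e) N.horizon

end Discrete

end DynamicNetwork

/-! ### Finite descriptions of networks and their size -/

/-- Right-continuous step function with initial value `c`; the list holds, in order of time, the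
times at which the value changes, each with the new value. -/
def stepFun {𝕋 : Type*} [LinearOrder 𝕋] : ℝ → List (𝕋 × ℝ) → 𝕋 → ℝ
  | c, [], _ => c
  | c, p :: l, x => if p.1 ≤ x then stepFun p.2 l x else c

theorem stepFun_nonneg {𝕋 : Type*} [LinearOrder 𝕋] (l : List (𝕋 × ℝ)) (c : ℝ) (hc : 0 ≤ c)
    (hl : ∀ p ∈ l, 0 ≤ p.2) (x : 𝕋) : 0 ≤ stepFun c l x := by
  induction l generalizing c with
  | nil => exact hc
  | cons p l ih =>
    simp only [stepFun]
    split_ifs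
    · exact ih p.2 (hl p (by simp)) fun q hq => hl q (by simp [hq])
    · exact hc

theorem stepFun_continuousAt {𝕋 : Type*} [LinearOrder 𝕋] [TopologicalSpace 𝕋] [OrderTopology 𝕋]
    (l : List (𝕋 × ℝ)) (c : ℝ) (x : 𝕋) (hx : ∀ p ∈ l, p.1 ≠ x) :
    ContinuousAt (stepFun c l) x := by
  induction l generalizing c with
  | nil => exact continuousAt_const
  | cons p l ih =>
    rcases lt_or_gt_of_ne (hx p (by simp)) with h | h
    · refine (ih p.2 fun q hq => hx q (by simp [hq])).congr ?_
      filter_upwards [Ioi_mem_nhds h] with y hy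
      simp [stepFun, le_of_lt (mem_Ioi.1 hy)]
    · refine (continuousAt_const (y := c)).congr ?_
      filter_upwards [Iio_mem_nhds h] with y hy
      simp [stepFun, not_le.2 (mem_Iio.1 hy)]

/-- A finite description of a network on the vertices `0, …, n - 1` with piecewise constant
capacities: all capacities are nonnegative rationals, all times are numbers in `K`
(nonnegative rationals for continuous time, natural numbers for discrete time). -/
structure NetworkCode (K : Type) where
  n : ℕ
  source : Fin n
  sink : Fin n
  source_ne_sink : source ≠ sink
  edges : Finset (Fin n × Fin n)
  initCap : Fin n × Fin n → ℚ≥0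
  capSteps : Fin n × Fin n → List (K × ℚ≥0)
  transit : Fin n × Fin n → K
  horizon : K

/-- Bit length of a nonnegative rational, as numerator and denominator in binary. -/
def nnratBits (q : ℚ≥0) : ℕ := Nat.size q.num + Nat.size q.den

namespace NetworkCode

variable {K : Type}

/-- Size of the description: number of vertices and edges plus the bit lengths of all capacities,
times of capacity changes, transit times and the horizon. -/
def size (bits : K → ℕ) (c : NetworkCode K) : ℕ :=
  c.n + bits c.horizon + ∑ e ∈ c.edges, (1 + bits (c.transit e) + nnratBits (c.initCap e) +
    ((c.capSteps e).map fun p => bits p.1 + nnratBits p.2).sum)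

/-- The network described by `c`, with times read in `𝕋` through `ι`. -/
def toNetwork {𝕋 : Type} [Zero 𝕋] [LinearOrder 𝕋] [TopologicalSpace 𝕋] [OrderTopology 𝕋]
    (ι : K → 𝕋) (hι : ∀ k, 0 ≤ ι k) (c : NetworkCode K) : DynamicNetwork 𝕋 (Fin c.n) where
  source := c.source
  sink := c.sink
  source_ne_sink := c.source_ne_sink
  edges := c.edges
  cap e := stepFun (c.initCap e : ℝ) ((c.capSteps e).map fun p => (ι p.1, (p.2 : ℝ)))
  transit e := ι (c.transit e)
  horizon := ι c.horizon
  horizon_nonneg := hι _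
  transit_nonneg _ _ := hι _
  cap_nonneg e _ θ _ := by
    refine stepFun_nonneg _ _ (by positivity) ?_ θ
    simp only [List.mem_map, forall_exists_index, and_imp]
    rintro _ p - rfl
    positivity
  cap_continuousOn e _ := by
    refine ⟨{x | ∃ p ∈ c.capSteps e, ι p.1 = x}, ?_, ?_⟩
    · refine ((c.capSteps e).map fun p => ι p.1).finite_toSet.subset ?_
      rintro x ⟨p, hp, rfl⟩
      exact List.mem_map.2 ⟨p, hp, rfl⟩
    · intro x hx
      refine (stepFun_continuousAt _ _ x ?_).continuousWithinAt
      simp only [List.mem_map, forall_exists_index, and_imp]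
      rintro _ p hp rfl h
      exact hx.2 ⟨p, hp, h⟩

/-- The continuous-time network described by `c`. -/
noncomputable def toCont (c : NetworkCode ℚ≥0) : DynamicNetwork ℝ (Fin c.n) :=
  c.toNetwork (fun q : ℚ≥0 => (q : ℝ)) fun q => NNRat.cast_nonneg q

/-- The discrete-time network described by `c`. -/
noncomputable def toDisc (c : NetworkCode ℕ) : DynamicNetwork ℤ (Fin c.n) :=
  c.toNetwork (fun k : ℕ => (k : ℤ)) fun k => Int.natCast_nonneg k

end NetworkCode

open MeasureTheory

/-! ### Changes of piecewise constant functions -/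

/-! The Fibonacci recursion yields an exponentially long alternating pattern from polynomially many
bits. The only capacity change closes the source edge after time step 0, so flow enters as a single
pulse. If an inner vertex `x` can be reached exactly at the even times below `2 * fib x`, then the
zero-delay edge from `x + 1` and the edge from `x` with delay `2 * fib (x + 1)` supply `x + 2` with
two disjoint blocks that together are the even times below `2 * fib (x + 2)`. Thus the last inner
vertex `m` sees the pulse at `fib m` isolated time steps.

The last edge has capacity 1, so every flow has value at most `fib m`. Sending one unit along every
path attains this bound, and equality forces the last edge to carry 1 at each active time and 0
otherwise (`flow_lastEdge_le`, `le_discFlowComplexity`). All other edges have capacity `fib m + 1`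
while open, too much for a minimum cut to pay even once. A minimum cut must therefore follow the
pulse up to `m`, and paying only `fib m` in total it has `m` on the source side at no other times
(`cut_eq_true_of_fibActive`, `le_discCutComplexity`). Both patterns switch at least `fib m` times,
and `m = 2 * l + 1` gives `fib m ≥ 2 ^ l`.

For continuous time, each time step becomes a unit interval. For almost every offset `θ` in `(0,
1)`, sampling a continuous flow or cut at the times `θ + k` gives a discrete one, and the continuous
value or capacity is the average of the discrete ones over `θ`. Hence discrete optima extend to
continuous optima, and almost all samples of a continuous optimum are discrete optima
(`IsContMaxFlow.ae_isDiscMaxFlow`, `IsContMinCut.ae_isDiscMinCut`). A piecewise constant function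
changes at least as often as almost every sample of it, so the discrete lower bound carries over. -/

theorem exists_change_of_ne {α : Type*} {g : ℝ → α} {D : ℝ} {F : Set ℝ} (hF : F.Finite)
    (hg : ∀ x y, 0 ≤ x → x ≤ y → y ≤ D → Disjoint (Icc x y) F → g x = g y)
    {a b : ℝ} (ha : 0 ≤ a) (hab : a < b) (hb : b ≤ D) (haF : a ∉ F) (hbF : b ∉ F)
    (hne : g a ≠ g b) :
    ∃ θ ∈ Ioo a b, ∀ᶠ ε in 𝓝[>] (0 : ℝ), g (θ - ε) ≠ g (θ + ε) := by
  classical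
  -- Induction on the number of exceptional points strictly between `a` and `b`. If the leftmost
  -- one, `p`, is not a change, then `g (p - ε) = g (p + ε)` for arbitrarily small `ε`, and `a` can
  -- be moved past `p` to `p + ε` without altering the value of `g`.
  obtain ⟨n, hn⟩ : ∃ n, (hF.toFinset.filter fun x => a < x ∧ x < b).card = n := ⟨_, rfl⟩
  induction n using Nat.strong_induction_on generalizing a with
  | _ n ih =>
  set G := hF.toFinset.filter fun x => a < x ∧ x < b with hG
  have memG : ∀ x, x ∈ G ↔ x ∈ F ∧ a < x ∧ x < b := by simp [hG]
  rcases G.eq_empty_or_nonempty with hE | hE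
  · refine absurd (hg a b ha hab.le hb ?_) hne
    rw [Set.disjoint_left]
    intro x hx hxF
    have h1 : a ≠ x := fun h => haF (h ▸ hxF)
    have h2 : x ≠ b := fun h => hbF (h ▸ hxF)
    have := (memG x).2 ⟨hxF, lt_of_le_of_ne hx.1 h1, lt_of_le_of_ne hx.2 h2⟩
    simp [hE] at this
  obtain ⟨p, hpG, hpmin⟩ := G.exists_min_image id hE
  obtain ⟨hpF, hap, hpb⟩ := (memG p).1 hpG
  by_cases hc : ∀ᶠ ε in 𝓝[>] (0 : ℝ), g (p - ε) ≠ g (p + ε)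
  · exact ⟨p, ⟨hap, hpb⟩, hc⟩
  have hfr : ∃ᶠ ε in 𝓝[>] (0 : ℝ), g (p - ε) = g (p + ε) := by
    simpa only [not_eventually, not_not, ne_eq] using hc
  have h0 : ∀ᶠ ε in 𝓝[>] (0 : ℝ), 0 < ε := self_mem_nhdsWithin
  have h1 : ∀ᶠ ε in 𝓝[>] (0 : ℝ), ε < p - a :=
    mem_nhdsWithin_of_mem_nhds (Iio_mem_nhds (by linarith))
  have h2 : ∀ᶠ ε in 𝓝[>] (0 : ℝ), ε < b - p :=
    mem_nhdsWithin_of_mem_nhds (Iio_mem_nhds (by linarith))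
  have h3 : ∀ᶠ ε in 𝓝[>] (0 : ℝ), p + ε ∉ F := by
    -- The offset 0 has to be removed because `p` itself lies in `F`; the remaining bad offsets form
    -- a finite, hence closed, set that misses 0.
    have hfin : ((fun ε : ℝ => p + ε) ⁻¹' F \ {0}).Finite :=
      (hF.preimage (add_right_injective p).injOn).sdiff
    have := hfin.isClosed.compl_mem_nhds (x := (0 : ℝ)) (by simp)
    filter_upwards [mem_nhdsWithin_of_mem_nhds this, h0] with ε hε hpos hmem
    exact hε ⟨hmem, by simpa using hpos.ne'⟩
  obtain ⟨ε, ⟨⟨⟨⟨heq, e0⟩, e1⟩, e2⟩, e3⟩⟩ :=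
    ((((hfr.and_eventually h0).and_eventually h1).and_eventually h2).and_eventually h3).exists
  have hga : g a = g (p - ε) := by
    refine hg _ _ ha (by linarith) (by linarith) ?_
    rw [Set.disjoint_left]
    intro x hx hxF
    have h1 : a ≠ x := fun h => haF (h ▸ hxF)
    have hxp : x < p := lt_of_le_of_lt hx.2 (by linarith)
    have := hpmin x ((memG x).2 ⟨hxF, lt_of_le_of_ne hx.1 h1, hxp.trans hpb⟩)
    simp only [id] at this
    linarith
  have hlt : (hF.toFinset.filter fun x => p + ε < x ∧ x < b).card < n := by
    rw [← hn]
    refine Finset.card_lt_card (Finset.ssubset_iff_of_subset ?_ |>.2 ⟨p, hpG, by simp; intros; linarith⟩)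
    intro x hx
    simp only [Finset.mem_filter, Finite.mem_toFinset] at hx
    exact (memG x).2 ⟨hx.1, by linarith, hx.2.2⟩
  obtain ⟨θ, hθ, h⟩ := ih _ hlt (a := p + ε) (by linarith) (by linarith) e3
    (by rw [← heq, ← hga]; exact hne) rfl
  exact ⟨θ, ⟨by linarith [hθ.1], hθ.2⟩, h⟩

/-- Each change of the sample forces a change of `g` strictly between the two sampling points, and
these open intervals are disjoint for different `k`. -/
theorem discChanges_le_contChanges {α : Type*} {g : ℝ → α} {D : ℤ} {F : Set ℝ} (hF : F.Finite)
    (hg : ∀ x y, 0 ≤ x → x ≤ y → y ≤ (D : ℝ) + 1 → Disjoint (Icc x y) F → g x = g y)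
    {θ : ℝ} (hθ : θ ∈ Ioo (0 : ℝ) 1) (hθF : ∀ k : ℤ, θ + k ∉ F) :
    discChanges (fun k : ℤ => g (θ + k)) D ≤ contChanges g (D + 1) := by
  have key : ∀ k ∈ {k : ℤ | k ∈ Ioc 0 D ∧ g (θ + (k - 1 : ℤ)) ≠ g (θ + k)},
      ∃ x ∈ Ioo (θ + (k - 1 : ℤ)) (θ + k), ∀ᶠ ε in 𝓝[>] (0 : ℝ), g (x - ε) ≠ g (x + ε) := by
    rintro k ⟨⟨h1, h2⟩, h3⟩
    have h1' : (1 : ℝ) ≤ k := by exact_mod_cast h1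
    have h2' : (k : ℝ) ≤ D := by exact_mod_cast h2
    refine exists_change_of_ne hF hg ?_ ?_ ?_ (hθF _) (hθF _) h3
    · push_cast; linarith [hθ.1]
    · push_cast; linarith
    · linarith [hθ.2]
  choose! x hx hc using key
  refine Set.encard_le_encard_of_injOn (f := x) ?_ ?_
  · intro k hk
    obtain ⟨⟨h1, h2⟩, -⟩ := id hk
    have h1' : (1 : ℝ) ≤ k := by exact_mod_cast h1
    have h2' : (k : ℝ) ≤ D := by exact_mod_cast h2
    have := hx k hk
    push_cast at this
    exact ⟨⟨by linarith [this.1, hθ.1], by linarith [this.2, hθ.2]⟩, hc k hk⟩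
  · intro k hk k' hk' hkk
    have a := hx k hk
    have b := hx k' hk'
    rw [hkk] at a
    have h1 : ((k - 1 : ℤ) : ℝ) < k' := by linarith [a.1, b.2]
    have h2 : ((k' - 1 : ℤ) : ℝ) < k := by linarith [b.1, a.2]
    have h1 : k - 1 < k' := by exact_mod_cast h1
    have h2 : k' - 1 < k := by exact_mod_cast h2
    omega

theorem contChanges_comp_floor {α : Type*} (g : ℤ → α) (D : ℤ) :
    contChanges (fun θ : ℝ => g ⌊θ⌋) (D + 1) = discChanges g D := by
  have himg : {θ : ℝ | θ ∈ Ioo (0 : ℝ) (D + 1) ∧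
      ∀ᶠ ε in 𝓝[>] (0 : ℝ), g ⌊θ - ε⌋ ≠ g ⌊θ + ε⌋} =
      (fun k : ℤ => (k : ℝ)) '' {k : ℤ | k ∈ Ioc 0 D ∧ g (k - 1) ≠ g k} := by
    have h0 : ∀ᶠ ε in 𝓝[>] (0 : ℝ), 0 < ε := self_mem_nhdsWithin
    have h1 : ∀ δ : ℝ, 0 < δ → ∀ᶠ ε in 𝓝[>] (0 : ℝ), ε < δ := fun δ hδ =>
      mem_nhdsWithin_of_mem_nhds (Iio_mem_nhds hδ)
    have hint : ∀ k : ℤ, ∀ᶠ ε in 𝓝[>] (0 : ℝ), ⌊(k : ℝ) - ε⌋ = k - 1 ∧ ⌊(k : ℝ) + ε⌋ = k := by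
      intro k
      filter_upwards [h0, h1 1 one_pos] with ε e0 e1
      constructor <;> rw [Int.floor_eq_iff] <;> constructor <;> push_cast <;> linarith
    ext θ
    constructor
    · rintro ⟨⟨hθ0, hθD⟩, hev⟩
      have hint' : θ = ⌊θ⌋ := by
        by_contra hne
        have hlt : (⌊θ⌋ : ℝ) < θ := lt_of_le_of_ne (Int.floor_le θ) (Ne.symm hne)
        have hlt' : θ < ⌊θ⌋ + 1 := Int.lt_floor_add_one θ
        obtain ⟨ε, ⟨⟨hε, e0⟩, e1⟩, e2⟩ := (((hev.and h0).and (h1 (θ - ⌊θ⌋) (by linarith))).and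
          (h1 (⌊θ⌋ + 1 - θ) (by linarith))).exists
        have ha : ⌊θ - ε⌋ = ⌊θ⌋ := by rw [Int.floor_eq_iff]; constructor <;> linarith
        have hb : ⌊θ + ε⌋ = ⌊θ⌋ := by rw [Int.floor_eq_iff]; constructor <;> linarith
        exact hε (by rw [ha, hb])
      refine ⟨⌊θ⌋, ⟨⟨?_, ?_⟩, ?_⟩, hint'.symm⟩
      · rw [hint'] at hθ0; exact_mod_cast hθ0
      · rw [hint'] at hθD
        have : ⌊θ⌋ < D + 1 := by exact_mod_cast hθD
        omega
      · rw [hint'] at hev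
        obtain ⟨ε, hε, ha, hb⟩ := (hev.and (hint ⌊θ⌋)).exists
        rwa [ha, hb] at hε
    · rintro ⟨k, ⟨⟨hk0, hkD⟩, hk⟩, rfl⟩
      refine ⟨⟨Int.cast_pos.2 hk0, ?_⟩, ?_⟩
      · have : k < D + 1 := by omega
        show (k : ℝ) < D + 1
        exact_mod_cast this
      · filter_upwards [hint k] with ε hε
        rw [hε.1, hε.2]
        exact hk
  unfold contChanges discChanges
  rw [himg]
  exact (Int.cast_injective.injOn).encard_image

/-- Agreement is required only off the integers, which leaves room for the exceptional endpoint
value of `extendCut`. -/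
theorem isPiecewiseConstant_of_eq_comp_floor {α : Type*} {f : ℝ → α} {g : ℤ → α} {D : ℝ}
    (hf : ∀ x ∈ Icc 0 D, (∀ k : ℤ, x ≠ k) → f x = g ⌊x⌋) : IsPiecewiseConstant f D := by
  refine ⟨(fun k : ℤ => (k : ℝ)) '' Icc 0 ⌊D⌋, (Set.finite_Icc 0 ⌊D⌋).image _, ?_⟩
  intro x y hx hxy hy hd
  have hd := Set.disjoint_left.1 hd
  have hint : ∀ z ∈ Icc x y, ∀ k : ℤ, z ≠ k := by
    rintro z hz k rfl
    refine hd hz ⟨k, ⟨?_, Int.le_floor.2 (hz.2.trans hy)⟩, rfl⟩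
    exact_mod_cast hx.trans hz.1
  have hfl : ⌊x⌋ = ⌊y⌋ := by
    by_contra hne
    have hlt : ⌊x⌋ < ⌊y⌋ := lt_of_le_of_ne (Int.floor_mono hxy) hne
    exact hint ⌊y⌋ ⟨(Int.floor_lt.1 hlt).le, Int.floor_le y⟩ _ rfl
  rw [hf x ⟨hx, hxy.trans hy⟩ (hint x (left_mem_Icc.2 hxy)),
    hf y ⟨hx.trans hxy, hy⟩ (hint y (right_mem_Icc.2 hxy)), hfl]

/-! ### Integration over unit steps -/

theorem intervalIntegrable_sum_shift {h : ℝ → ℝ} {n : ℤ}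
    (hh : ∀ k ∈ Finset.Icc 0 n, IntervalIntegrable h volume (k : ℝ) (k + 1)) :
    IntervalIntegrable (fun θ => ∑ k ∈ Finset.Icc 0 n, h (θ + (k : ℤ))) volume 0 1 := by
  have := IntervalIntegrable.sum (μ := volume) (a := 0) (b := 1) (Finset.Icc 0 n) (f := fun (k : ℤ) θ => h (θ + k)) ?_
  · simpa only [Finset.sum_fn] using this
  · intro k hk
    have := (hh k hk).comp_add_right (k : ℝ)
    simpa using this

/-- Folding the unit intervals onto `[0, 1]` turns an integral over time into an average of discrete
sums over the sampling offset. -/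
theorem integral_eq_integral_sum_shift {h : ℝ → ℝ} {n : ℤ} (hn : 0 ≤ n)
    (hh : ∀ k ∈ Finset.Icc 0 n, IntervalIntegrable h volume (k : ℝ) (k + 1)) :
    ∫ x in (0 : ℝ)..(n + 1), h x = ∫ θ in (0 : ℝ)..1, ∑ k ∈ Finset.Icc 0 n, h (θ + (k : ℤ)) := by
  rw [intervalIntegral.integral_finsetSum]
  swap
  · intro k hk
    have := (hh k hk).comp_add_right (k : ℝ)
    simpa using this
  obtain ⟨m, rfl⟩ := Int.eq_ofNat_of_zero_le hn
  have hsum : ∀ F : ℤ → ℝ, ∑ k ∈ Finset.Icc 0 (m : ℤ), F k = ∑ k ∈ Finset.range (m + 1), F k := by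
    intro F
    symm
    refine Finset.sum_bij (fun k _ => (k : ℤ)) ?_ ?_ ?_ ?_
    · intro k hk; simp at hk ⊢; omega
    · intro a _ b _ h; exact_mod_cast h
    · intro k hk
      simp at hk
      exact ⟨k.toNat, by simp; omega, by simp; omega⟩
    · intro k _; rfl
  rw [hsum]
  have := intervalIntegral.sum_integral_adjacent_intervals (f := h) (μ := volume)
    (a := fun k : ℕ => (k : ℝ)) (n := m + 1) ?_
  · simp only [Nat.cast_zero] at this
    push_cast at this ⊢
    rw [← this]
    refine Finset.sum_congr rfl fun k _ => ?_
    rw [intervalIntegral.integral_comp_add_right]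
    congr 1 <;> ring
  · intro k hk
    have := hh k (by simp; omega)
    push_cast at this ⊢
    exact this

theorem ae_forall_shift {P : ℝ → Prop} (hP : ∀ᵐ x : ℝ, P x) :
    ∀ᵐ θ : ℝ, ∀ k : ℤ, P (θ + k) := by
  rw [ae_all_iff]
  intro k
  exact (measurePreserving_add_right volume (k : ℝ)).quasiMeasurePreserving.ae hP

theorem ae_shift_notMem_of_finite {F : Set ℝ} (hF : F.Finite) : ∀ᵐ θ : ℝ, ∀ k : ℤ, θ + k ∉ F :=
  ae_forall_shift (measure_eq_zero_iff_ae_notMem.1 (hF.measure_zero volume))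

/-- Lebesgue differentiation: almost everywhere `h` is the derivative of its primitive, which is
constant here. This makes integrated flow conservation pointwise. -/
theorem ae_eq_zero_of_forall_intervalIntegral_eq_zero {h : ℝ → ℝ} {D : ℝ}
    (hh : LocallyIntegrable h volume) (h0 : ∀ x ∈ Icc 0 D, ∫ ζ in (0 : ℝ)..x, h ζ = 0) :
    ∀ᵐ x : ℝ, x ∈ Ioo 0 D → h x = 0 := by
  filter_upwards [LocallyIntegrable.ae_hasDerivAt_integral hh] with x hx hxD
  have h1 := hx 0
  have h2 : HasDerivAt (fun _ : ℝ => (0 : ℝ)) (h x) x := by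
    refine h1.congr_of_eventuallyEq ?_
    filter_upwards [Ioo_mem_nhds hxD.1 hxD.2] with y hy
    exact (h0 y ⟨hy.1.le, hy.2.le⟩).symm
  exact h2.unique (hasDerivAt_const x 0)

/-! ### From discrete to continuous time -/

namespace DynamicNetwork

variable {V : Type*}

/-- `M` is the continuous-time network in which every time step `k` of `N` has become the unit
interval `[k, k + 1)`. -/
structure IsContExtension (N : DynamicNetwork ℤ V) (M : DynamicNetwork ℝ V) : Prop where
  source : M.source = N.source
  sink : M.sink = N.sink
  edges : M.edges = N.edges
  transit : ∀ e, M.transit e = N.transit e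
  horizon : M.horizon = N.horizon + 1
  cap : ∀ e θ, M.cap e θ = N.cap e ⌊θ⌋

variable {N : DynamicNetwork ℤ V} {M : DynamicNetwork ℝ V}

theorem floor_add_intCast_of_mem_Ioo {θ : ℝ} (hθ : θ ∈ Ioo (0 : ℝ) 1) (k : ℤ) : ⌊θ + k⌋ = k := by
  rw [Int.floor_eq_iff]; constructor <;> linarith [hθ.1, hθ.2]

theorem netInflow_shift [DecidableEq V] (h : N.IsContExtension M) (f : V × V → ℝ → ℝ) (v : V)
    (θ : ℝ) (k : ℤ) :
    M.netInflow f v (θ + k) = N.netInflow (fun e (j : ℤ) => f e (θ + j)) v k := by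
  unfold netInflow
  rw [h.edges]
  congr 1
  refine Finset.sum_congr rfl fun e _ => ?_
  rw [h.transit]
  push_cast
  rw [add_sub_assoc]

theorem netInflow_floor [DecidableEq V] (h : N.IsContExtension M) (g : V × V → ℤ → ℝ) (v : V)
    (θ : ℝ) : M.netInflow (fun e x => g e ⌊x⌋) v θ = N.netInflow g v ⌊θ⌋ := by
  unfold netInflow
  rw [h.edges]
  congr 1
  refine Finset.sum_congr rfl fun e _ => ?_
  simp only [h.transit, Int.floor_sub_intCast]

theorem cutRate_shift (h : N.IsContExtension M) (S : V → ℝ → Bool) {θ : ℝ}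
    (hθ : θ ∈ Ioo (0 : ℝ) 1) (k : ℤ) :
    M.cutRate S (θ + k) = N.cutRate (fun v (j : ℤ) => S v (θ + j)) k := by
  unfold cutRate
  rw [h.edges]
  refine Finset.sum_congr ?_ fun e _ => ?_
  · ext e
    rw [Finset.mem_filter, Finset.mem_filter, h.transit]
    push_cast
    rw [add_assoc]
  · rw [h.cap, floor_add_intCast_of_mem_Ioo hθ]

theorem locallyIntegrable_of_abs_le {g : ℝ → ℝ} {B : ℝ} (hg : Measurable g)
    (hB : ∀ x, |g x| ≤ B) : LocallyIntegrable g volume :=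
  (locallyIntegrable_const B).mono hg.aestronglyMeasurable
    (ae_of_all _ fun x => by
      rw [Real.norm_eq_abs, Real.norm_eq_abs]; exact (hB x).trans (le_abs_self B))

/-! ### Flows: samples, averages and maximality -/

section Flow

variable [DecidableEq V]

theorem IsContFlow.exists_abs_le (h : N.IsContExtension M) {f : V × V → ℝ → ℝ}
    (hf : M.IsContFlow f) {e : V × V} (he : e ∈ M.edges) : ∃ B, ∀ x, |f e x| ≤ B := by
  -- On the domain of `f e` the capacity takes only the values at finitely many floors; `N.horizon +
  -- 1` occurs as the floor of the right endpoint when the transit time is 0.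
  refine ⟨∑ k ∈ Finset.Icc 0 (N.horizon + 1), |N.cap e k|, fun x => ?_⟩
  by_cases hx : x ∈ Icc 0 (M.horizon - M.transit e)
  · rw [abs_of_nonneg (hf.feasible.nonneg e he x hx)]
    refine (hf.feasible.le_cap e he x hx).trans ?_
    rw [h.cap]
    refine (le_abs_self _).trans
      (Finset.single_le_sum (f := fun k => |N.cap e k|) (fun k _ => abs_nonneg _) ?_)
    rw [Finset.mem_Icc]
    refine ⟨Int.floor_nonneg.2 hx.1, Int.cast_le (R := ℝ).1 ?_⟩
    have h1 := hx.2
    have h2 := M.transit_nonneg e he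
    have h3 := Int.floor_le x
    rw [h.horizon] at h1
    push_cast
    linarith
  · rw [hf.feasible.eq_zero e he x hx, abs_zero]
    exact Finset.sum_nonneg fun k _ => abs_nonneg _

theorem IsContFlow.locallyIntegrable_netInflow (h : N.IsContExtension M) {f : V × V → ℝ → ℝ}
    (hf : M.IsContFlow f) (v : V) : LocallyIntegrable (M.netInflow f v) volume := by
  refine LocallyIntegrable.sub ?_ ?_
  · refine locallyIntegrable_finsetSum _ fun e he => ?_
    have he := (Finset.mem_filter.1 he).1
    obtain ⟨B, hB⟩ := hf.exists_abs_le h he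
    exact locallyIntegrable_of_abs_le ((hf.measurable e he).comp (measurable_id.sub_const _))
      fun x => hB _
  · refine locallyIntegrable_finsetSum _ fun e he => ?_
    have he := (Finset.mem_filter.1 he).1
    obtain ⟨B, hB⟩ := hf.exists_abs_le h he
    exact locallyIntegrable_of_abs_le (hf.measurable e he) hB

theorem IsContFlow.intervalIntegrable_netInflow (h : N.IsContExtension M) {f : V × V → ℝ → ℝ}
    (hf : M.IsContFlow f) (v : V) (a b : ℝ) :
    IntervalIntegrable (M.netInflow f v) volume a b :=
  ((hf.locallyIntegrable_netInflow h v).integrableOn_isCompact isCompact_uIcc).intervalIntegrable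

theorem IsContFlow.ae_isDiscFlow (h : N.IsContExtension M) {f : V × V → ℝ → ℝ} [Finite V]
    (hf : M.IsContFlow f) :
    ∀ᵐ θ : ℝ, θ ∈ Ioo (0 : ℝ) 1 → N.IsDiscFlow fun e (k : ℤ) => f e (θ + k) := by
  have hz : ∀ᵐ x : ℝ, ∀ v, v ≠ M.source → v ≠ M.sink → x ∈ Ioo 0 M.horizon →
      M.netInflow f v x = 0 := by
    rw [ae_all_iff]
    intro v
    by_cases hv : v ≠ M.source ∧ v ≠ M.sink
    · filter_upwards [ae_eq_zero_of_forall_intervalIntegral_eq_zero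
        (hf.locallyIntegrable_netInflow h v) (hf.conservation v hv.1 hv.2)] with x hx _ _
      exact hx
    · exact ae_of_all _ fun x h1 h2 => absurd ⟨h1, h2⟩ hv
  filter_upwards [ae_forall_shift hz] with θ hθz hθ
  refine ⟨⟨?_, ?_, ?_⟩, ?_⟩
  · intro e he k hk
    rw [← h.edges] at he
    refine hf.feasible.eq_zero e he _ fun hmem => hk ?_
    rw [h.horizon, h.transit] at hmem
    have h1 : (-1 : ℝ) < k := by linarith [hmem.1, hθ.2]
    have h2 : (k : ℝ) < (N.horizon : ℝ) + 1 - N.transit e := by linarith [hmem.2, hθ.1]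
    have h1 : -1 < k := by exact_mod_cast h1
    have h2 : k < N.horizon + 1 - N.transit e := by exact_mod_cast h2
    constructor <;> omega
  all_goals
    have hdom : ∀ e, ∀ k ∈ Icc 0 (N.horizon - N.transit e),
        θ + (k : ℤ) ∈ Icc 0 (M.horizon - M.transit e) := by
      rintro e k ⟨h1, h2⟩
      have h1 : (0 : ℝ) ≤ k := by exact_mod_cast h1
      have h2 : (k : ℝ) ≤ N.horizon - N.transit e := by exact_mod_cast h2
      rw [h.horizon, h.transit]
      constructor <;> linarith [hθ.1, hθ.2]
  · intro e he k hk
    exact hf.feasible.nonneg e (h.edges ▸ he) _ (hdom e k hk)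
  · intro e he k hk
    have := hf.feasible.le_cap e (h.edges ▸ he) _ (hdom e k hk)
    rwa [h.cap, floor_add_intCast_of_mem_Ioo hθ] at this
  · intro v hs ht k hk
    refine Finset.sum_eq_zero fun j hj => ?_
    rw [Finset.mem_Icc] at hj
    rw [← netInflow_shift h]
    refine hθz j v (h.source ▸ hs) (h.sink ▸ ht) ?_
    have h1 : (0 : ℝ) ≤ j := by exact_mod_cast hj.1
    have h2 : (j : ℝ) ≤ N.horizon := by exact_mod_cast hj.2.trans hk.2
    rw [h.horizon]
    constructor <;> linarith [hθ.1, hθ.2]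

theorem IsContFlow.intervalIntegrable_discFlowValue (h : N.IsContExtension M)
    {f : V × V → ℝ → ℝ} (hf : M.IsContFlow f) :
    IntervalIntegrable (fun θ : ℝ => N.discFlowValue fun e (k : ℤ) => f e (θ + k)) volume 0 1 := by
  have := intervalIntegrable_sum_shift (h := M.netInflow f M.sink) (n := N.horizon)
    fun k _ => hf.intervalIntegrable_netInflow h _ _ _
  simp only [netInflow_shift h, h.sink] at this
  exact this

theorem IsContFlow.contFlowValue_eq (h : N.IsContExtension M)
    {f : V × V → ℝ → ℝ} (hf : M.IsContFlow f) :
    M.contFlowValue f =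
      ∫ θ in (0 : ℝ)..1, N.discFlowValue fun e (k : ℤ) => f e (θ + k) := by
  have := integral_eq_integral_sum_shift (h := M.netInflow f M.sink) N.horizon_nonneg
    fun k _ => hf.intervalIntegrable_netInflow h _ _ _
  simp only [netInflow_shift h] at this
  unfold contFlowValue contExcess discFlowValue discExcess
  rw [h.horizon, this, h.sink]

/-- The net inflow is the difference of two consecutive excesses; outside the horizon every term
vanishes by the zero convention. -/
theorem IsDiscFlow.netInflow_eq_zero {g : V × V → ℤ → ℝ} (hg : N.IsDiscFlow g) {v : V}
    (hs : v ≠ N.source) (ht : v ≠ N.sink) (k : ℤ) : N.netInflow g v k = 0 := by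
  rcases lt_or_ge k 0 with hk0 | hk0
  · unfold netInflow
    rw [Finset.sum_eq_zero, Finset.sum_eq_zero, sub_zero]
    · intro e he
      exact hg.feasible.eq_zero e (Finset.mem_filter.1 he).1 _ fun hm => absurd hm.1 (by omega)
    · intro e he
      have he := (Finset.mem_filter.1 he).1
      have := N.transit_nonneg e he
      exact hg.feasible.eq_zero e he _ fun hm => absurd hm.1 (by omega)
  rcases lt_or_ge N.horizon k with hk | hk
  · unfold netInflow
    rw [Finset.sum_eq_zero, Finset.sum_eq_zero, sub_zero]
    · intro e he
      have he := (Finset.mem_filter.1 he).1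
      have := N.transit_nonneg e he
      exact hg.feasible.eq_zero e he _ fun hm => absurd hm.2 (by omega)
    · intro e he
      exact hg.feasible.eq_zero e (Finset.mem_filter.1 he).1 _ fun hm => absurd hm.2 (by omega)
  -- Starting at -1, where the sum is empty, makes the difference argument cover `k = 0` as well.
  have hsum : ∀ j ∈ Icc (-1 : ℤ) N.horizon, N.discExcess g v j = 0 := by
    rintro j ⟨h1, h2⟩
    rcases eq_or_lt_of_le h1 with rfl | h1
    · simp [discExcess]
    · exact hg.conservation v hs ht j ⟨by omega, h2⟩
  have h1 := hsum k ⟨by omega, hk⟩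
  have h2 := hsum (k - 1) ⟨by omega, by omega⟩
  have hins : Finset.Icc 0 k = insert k (Finset.Icc 0 (k - 1)) := by
    ext j; simp only [Finset.mem_Icc, Finset.mem_insert]; omega
  unfold discExcess at h1 h2
  rw [hins, Finset.sum_insert (by simp), h2, add_zero] at h1
  exact h1

theorem IsDiscFlow.isContFlow_comp_floor (h : N.IsContExtension M) {g : V × V → ℤ → ℝ}
    (hg : N.IsDiscFlow g) : M.IsContFlow fun e θ => g e ⌊θ⌋ := by
  have hnn : ∀ e ∈ N.edges, ∀ k, 0 ≤ g e k := by
    intro e he k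
    by_cases hk : k ∈ Icc 0 (N.horizon - N.transit e)
    · exact hg.feasible.nonneg e he k hk
    · exact (hg.feasible.eq_zero e he k hk).ge
  refine ⟨?_, ⟨?_, ?_, ?_⟩, ?_⟩
  · intro e _
    exact (measurable_from_top (f := g e)).comp Int.measurable_floor
  · intro e he θ hθ
    refine hg.feasible.eq_zero e (h.edges ▸ he) _ fun hm => hθ ?_
    rw [h.horizon, h.transit]
    refine ⟨Int.floor_nonneg.1 hm.1, ?_⟩
    have := Int.lt_floor_add_one θ
    have h2 : (⌊θ⌋ : ℝ) ≤ N.horizon - N.transit e := by exact_mod_cast hm.2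
    linarith
  · intro e he θ _
    exact hnn e (h.edges ▸ he) _
  · intro e he θ hθ
    by_cases hk : ⌊θ⌋ ∈ Icc 0 (N.horizon - N.transit e)
    · rw [h.cap]
      exact hg.feasible.le_cap e (h.edges ▸ he) _ hk
    -- The right endpoint of the continuous domain has its floor outside the discrete domain; there
    -- the flow is 0.
    · rw [hg.feasible.eq_zero e (h.edges ▸ he) _ hk]
      exact M.cap_nonneg e he θ ⟨hθ.1, hθ.2.trans (sub_le_self _ (M.transit_nonneg e he))⟩
  · intro v hs ht θ _
    unfold contExcess
    rw [h.source] at hs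
    rw [h.sink] at ht
    simp only [netInflow_floor h, hg.netInflow_eq_zero hs ht, intervalIntegral.integral_zero]

theorem IsDiscFlow.contFlowValue_comp_floor (h : N.IsContExtension M) {g : V × V → ℤ → ℝ}
    (hg : N.IsDiscFlow g) : M.contFlowValue (fun e θ => g e ⌊θ⌋) = N.discFlowValue g := by
  rw [(hg.isContFlow_comp_floor h).contFlowValue_eq h]
  have : ∫ θ in (0 : ℝ)..1, N.discFlowValue (fun e (k : ℤ) => g e ⌊θ + k⌋) =
      ∫ θ in (0 : ℝ)..1, N.discFlowValue g := by
    refine intervalIntegral.integral_congr_Ioo_of_le zero_le_one fun θ hθ => ?_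
    simp only [floor_add_intCast_of_mem_Ioo hθ]
  rw [this]
  simp

theorem ae_restrict_Ioc_of_ae_Ioo {P : ℝ → Prop} (hP : ∀ᵐ θ : ℝ, θ ∈ Ioo (0 : ℝ) 1 → P θ) :
    ∀ᵐ θ ∂(volume.restrict (Ioc (0 : ℝ) 1)), P θ := by
  rw [ae_restrict_congr_set Ioo_ae_eq_Ioc.symm, ae_restrict_iff' measurableSet_Ioo]
  exact hP

/-- If an average of values `a θ ≤ A` reaches `A`, then almost all of them are equal to `A`. -/
theorem ae_eq_of_le_of_integral_ge {a : ℝ → ℝ} {A : ℝ} (hint : IntervalIntegrable a volume 0 1)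
    (hle : ∀ᵐ θ : ℝ, θ ∈ Ioo (0 : ℝ) 1 → a θ ≤ A) (hge : A ≤ ∫ θ in (0 : ℝ)..1, a θ) :
    ∀ᵐ θ : ℝ, θ ∈ Ioo (0 : ℝ) 1 → a θ = A := by
  have hint' : IntervalIntegrable (fun θ => A - a θ) volume 0 1 :=
    intervalIntegrable_const.sub hint
  have hnn : 0 ≤ᵐ[volume.restrict (Ioc (0 : ℝ) 1)] fun θ => A - a θ :=
    ae_restrict_Ioc_of_ae_Ioo (hle.mono fun θ hθ h => sub_nonneg.2 (hθ h))
  have h0 : ∫ θ in (0 : ℝ)..1, (A - a θ) = 0 := by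
    refine le_antisymm ?_ (intervalIntegral.integral_nonneg_of_ae_restrict zero_le_one ?_)
    · rw [intervalIntegral.integral_sub intervalIntegrable_const hint]
      simpa using hge
    · rw [restrict_Ioc_eq_restrict_Icc] at hnn
      exact hnn
  have := (intervalIntegral.integral_eq_zero_iff_of_le_of_nonneg_ae zero_le_one hnn hint').1 h0
  rw [← ae_restrict_iff' measurableSet_Ioo, ae_restrict_congr_set Ioo_ae_eq_Ioc]
  exact this.mono fun θ hθ => (sub_eq_zero.1 hθ).symm

theorem IsDiscMaxFlow.isContMaxFlow_comp_floor [Finite V] (h : N.IsContExtension M)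
    {g : V × V → ℤ → ℝ} (hg : N.IsDiscMaxFlow g) : M.IsContMaxFlow fun e θ => g e ⌊θ⌋ := by
  refine ⟨hg.1.isContFlow_comp_floor h, fun f' hf' => ?_⟩
  rw [hg.1.contFlowValue_comp_floor h, hf'.contFlowValue_eq h]
  calc _ ≤ ∫ θ in (0 : ℝ)..1, N.discFlowValue g := by
        refine intervalIntegral.integral_mono_ae_restrict zero_le_one
          (hf'.intervalIntegrable_discFlowValue h) intervalIntegrable_const ?_
        rw [← restrict_Ioc_eq_restrict_Icc]
        exact ae_restrict_Ioc_of_ae_Ioo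
          ((hf'.ae_isDiscFlow h).mono fun θ hθ h => hg.2 _ (hθ h))
    _ = _ := by simp

theorem IsContMaxFlow.ae_isDiscMaxFlow [Finite V] (h : N.IsContExtension M)
    {g : V × V → ℤ → ℝ} (hg : N.IsDiscMaxFlow g) {f : V × V → ℝ → ℝ} (hf : M.IsContMaxFlow f) :
    ∀ᵐ θ : ℝ, θ ∈ Ioo (0 : ℝ) 1 → N.IsDiscMaxFlow fun e (k : ℤ) => f e (θ + k) := by
  have hflow := hf.1.ae_isDiscFlow h
  have hval := hf.2 _ (hg.1.isContFlow_comp_floor h)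
  rw [hg.1.contFlowValue_comp_floor h, hf.1.contFlowValue_eq h] at hval
  filter_upwards [hflow, ae_eq_of_le_of_integral_ge (hf.1.intervalIntegrable_discFlowValue h)
    (hflow.mono fun θ hθ h => hg.2 _ (hθ h)) hval] with θ h1 h2 hθ
  exact ⟨h1 hθ, fun f' hf' => (hg.2 f' hf').trans (h2 hθ).ge⟩

end Flow

end DynamicNetwork

namespace DynamicNetwork

variable {V : Type*} {N : DynamicNetwork ℤ V} {M : DynamicNetwork ℝ V}

/-! ### Cuts: samples, averages and minimality -/

section Cut

theorem measurable_cutRate (h : N.IsContExtension M) {S : V → ℝ → Bool}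
    (hS : ∀ v, Measurable (S v)) : Measurable (M.cutRate S) := by
  unfold cutRate
  simp only [Finset.sum_filter]
  refine Finset.measurable_fun_sum _ fun e _ => Measurable.ite ?_ ?_ measurable_const
  · exact (hS e.1 (measurableSet_singleton true)).inter
      (((hS e.2).comp (measurable_id.add_const _)) (measurableSet_singleton false))
  · have : M.cap e = fun θ => N.cap e ⌊θ⌋ := funext (h.cap e)
    rw [this]
    exact (measurable_from_top (f := N.cap e)).comp Int.measurable_floor

theorem intervalIntegrable_cutRate (h : N.IsContExtension M) {S : V → ℝ → Bool}
    (hS : ∀ v, Measurable (S v)) (k : ℤ) :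
    IntervalIntegrable (M.cutRate S) volume (k : ℝ) (k + 1) := by
  refine (intervalIntegrable_const
    (c := ∑ e ∈ M.edges, (|N.cap e k| + |N.cap e (k + 1)|))).mono_fun'
    (measurable_cutRate h hS).aestronglyMeasurable ?_
  refine (ae_restrict_iff' measurableSet_uIoc).2 (ae_of_all _ fun θ hθ => ?_)
  rw [uIoc_of_le (by linarith)] at hθ
  -- The half-open interval contains its right endpoint, so the bound must allow for the capacities
  -- of the next step too.
  have hfl : ⌊θ⌋ = k ∨ ⌊θ⌋ = k + 1 := by
    have h1 : k ≤ ⌊θ⌋ := Int.le_floor.2 hθ.1.le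
    have h2 : ⌊θ⌋ ≤ k + 1 := by
      have := (Int.floor_le θ).trans hθ.2
      exact_mod_cast this
    omega
  unfold cutRate
  refine (Finset.abs_sum_le_sum_abs _ _).trans ?_
  refine (Finset.sum_le_sum_of_subset_of_nonneg (Finset.filter_subset _ _)
    fun e _ _ => abs_nonneg _).trans (Finset.sum_le_sum fun e _ => ?_)
  rw [h.cap]
  rcases hfl with hfl | hfl <;> rw [hfl] <;>
    linarith [abs_nonneg (N.cap e k), abs_nonneg (N.cap e (k + 1))]

theorem sum_cutRate_shift (h : N.IsContExtension M) (S : V → ℝ → Bool) {θ : ℝ}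
    (hθ : θ ∈ Ioo (0 : ℝ) 1) :
    ∑ k ∈ Finset.Icc 0 N.horizon, M.cutRate S (θ + (k : ℤ)) =
      N.discCutCapacity fun v (k : ℤ) => S v (θ + k) :=
  Finset.sum_congr rfl fun k _ => cutRate_shift h S hθ k

theorem intervalIntegrable_discCutCapacity (h : N.IsContExtension M) {S : V → ℝ → Bool}
    (hS : ∀ v, Measurable (S v)) :
    IntervalIntegrable (fun θ : ℝ => N.discCutCapacity fun v (k : ℤ) => S v (θ + k))
      volume 0 1 := by
  refine (intervalIntegrable_sum_shift (n := N.horizon)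
    fun k _ => intervalIntegrable_cutRate h hS k).congr_ae ?_
  rw [uIoc_of_le zero_le_one]
  exact ae_restrict_Ioc_of_ae_Ioo (ae_of_all _ fun θ hθ => sum_cutRate_shift h S hθ)

theorem contCutCapacity_eq (h : N.IsContExtension M) {S : V → ℝ → Bool}
    (hS : ∀ v, Measurable (S v)) :
    M.contCutCapacity S =
      ∫ θ in (0 : ℝ)..1, N.discCutCapacity fun v (k : ℤ) => S v (θ + k) := by
  unfold contCutCapacity
  rw [h.horizon, integral_eq_integral_sum_shift N.horizon_nonneg
    fun k _ => intervalIntegrable_cutRate h hS k]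
  exact intervalIntegral.integral_congr_Ioo_of_le zero_le_one fun θ hθ =>
    sum_cutRate_shift h S hθ

theorem IsCut.shift (h : N.IsContExtension M) {S : V → ℝ → Bool} (hS : M.IsCut S) {θ : ℝ}
    (hθ : θ ∈ Ioo (0 : ℝ) 1) : N.IsCut fun v (k : ℤ) => S v (θ + k) := by
  have hdom : ∀ k ∈ Icc 0 N.horizon, θ + (k : ℤ) ∈ Icc 0 M.horizon := by
    rintro k ⟨h1, h2⟩
    have h1 : (0 : ℝ) ≤ k := by exact_mod_cast h1
    have h2 : (k : ℝ) ≤ N.horizon := by exact_mod_cast h2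
    rw [h.horizon]
    constructor <;> linarith [hθ.1, hθ.2]
  refine ⟨fun k hk => ?_, fun k hk => ?_, fun v k hk => ?_⟩
  · rw [← h.source]; exact hS.source_mem _ (hdom k hk)
  · rw [← h.sink]; exact hS.sink_notMem _ (hdom k hk)
  · refine hS.after_horizon _ _ ?_
    have hk : (N.horizon : ℝ) + 1 ≤ k := by exact_mod_cast hk
    rw [h.horizon]
    linarith [hθ.1]

/-- The continuous-time cut that is constant on every unit interval; at the horizon it keeps the
value of the last time step. -/
noncomputable def extendCut (N : DynamicNetwork ℤ V) (S : V → ℤ → Bool) (v : V) (θ : ℝ) : Bool :=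
  if θ = N.horizon + 1 then S v N.horizon else S v ⌊θ⌋

theorem extendCut_shift (S : V → ℤ → Bool) (v : V) {θ : ℝ} (hθ : θ ∈ Ioo (0 : ℝ) 1) (k : ℤ) :
    N.extendCut S v (θ + k) = S v k := by
  have hfl := floor_add_intCast_of_mem_Ioo hθ k
  unfold extendCut
  rw [if_neg, hfl]
  intro heq
  have h1 : ⌊θ + k⌋ = N.horizon + 1 := by
    rw [heq]; exact_mod_cast Int.floor_intCast (R := ℝ) (N.horizon + 1)
  rw [hfl] at h1
  rw [h1] at heq
  push_cast at heq
  linarith [hθ.1]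

theorem IsCut.isContCut_extendCut (h : N.IsContExtension M) {S : V → ℤ → Bool}
    (hS : N.IsCut S) : M.IsContCut (N.extendCut S) := by
  have hT := N.horizon_nonneg
  -- The endpoint `N.horizon + 1` still belongs to the continuous horizon, but at that discrete time
  -- the convention puts even the sink on the source side. Hence the special value in `extendCut`.
  have hfl : ∀ θ : ℝ, θ ∈ Icc 0 M.horizon → θ ≠ N.horizon + 1 → ⌊θ⌋ ∈ Icc 0 N.horizon := by
    intro θ hθ hne
    rw [h.horizon] at hθ
    refine ⟨Int.floor_nonneg.2 hθ.1, Int.lt_add_one_iff.1 (Int.floor_lt.2 ?_)⟩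
    push_cast
    exact lt_of_le_of_ne hθ.2 hne
  refine ⟨⟨fun θ hθ => ?_, fun θ hθ => ?_, fun v θ hθ => ?_⟩, fun v => ?_⟩
  · rw [h.source]
    unfold extendCut
    split_ifs with hc
    · exact hS.source_mem _ ⟨hT, le_rfl⟩
    · exact hS.source_mem _ (hfl θ hθ hc)
  · rw [h.sink]
    unfold extendCut
    split_ifs with hc
    · exact hS.sink_notMem _ ⟨hT, le_rfl⟩
    · exact hS.sink_notMem _ (hfl θ hθ hc)
  · rw [h.horizon] at hθ
    unfold extendCut
    rw [if_neg hθ.ne']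
    refine hS.after_horizon _ _ (Int.lt_of_add_one_le (Int.le_floor.2 ?_))
    push_cast
    exact hθ.le
  · exact Measurable.ite (measurableSet_singleton _) measurable_const
      ((measurable_from_top (f := S v)).comp Int.measurable_floor)

theorem isPiecewiseConstantCut_extendCut (S : V → ℤ → Bool) :
    M.IsPiecewiseConstantCut (N.extendCut S) := by
  intro v
  refine isPiecewiseConstant_of_eq_comp_floor (g := S v) fun x _ hx => ?_
  unfold extendCut
  rw [if_neg]
  have := hx (N.horizon + 1)
  push_cast at this
  exact this

theorem IsDiscMinCut.contCutCapacity_extendCut (h : N.IsContExtension M) {S : V → ℤ → Bool}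
    (hS : N.IsDiscMinCut S) : M.contCutCapacity (N.extendCut S) = N.discCutCapacity S := by
  rw [contCutCapacity_eq h (hS.1.isContCut_extendCut h).2]
  have : ∫ θ in (0 : ℝ)..1, N.discCutCapacity (fun v (k : ℤ) => N.extendCut S v (θ + k)) =
      ∫ θ in (0 : ℝ)..1, N.discCutCapacity S :=
    intervalIntegral.integral_congr_Ioo_of_le zero_le_one fun θ hθ => by
      simp only [extendCut_shift S _ hθ]
  rw [this]
  simp

theorem IsDiscMinCut.isContMinCut_extendCut (h : N.IsContExtension M) {S : V → ℤ → Bool}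
    (hS : N.IsDiscMinCut S) : M.IsContMinCut (N.extendCut S) := by
  refine ⟨hS.1.isContCut_extendCut h, fun S' hS' => ?_⟩
  rw [hS.contCutCapacity_extendCut h, contCutCapacity_eq h hS'.2]
  calc N.discCutCapacity S = ∫ θ in (0 : ℝ)..1, N.discCutCapacity S := by simp
    _ ≤ _ := by
        refine intervalIntegral.integral_mono_ae_restrict zero_le_one
          intervalIntegrable_const (intervalIntegrable_discCutCapacity h hS'.2) ?_
        rw [← restrict_Ioc_eq_restrict_Icc]
        exact ae_restrict_Ioc_of_ae_Ioo (ae_of_all _ fun θ hθ => hS.2 _ (hS'.1.shift h hθ))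

theorem IsContMinCut.ae_isDiscMinCut (h : N.IsContExtension M) {S₀ : V → ℤ → Bool}
    (hS₀ : N.IsDiscMinCut S₀) {S : V → ℝ → Bool} (hS : M.IsContMinCut S) :
    ∀ᵐ θ : ℝ, θ ∈ Ioo (0 : ℝ) 1 → N.IsDiscMinCut fun v (k : ℤ) => S v (θ + k) := by
  have hval := hS.2 _ (hS₀.1.isContCut_extendCut h)
  rw [hS₀.contCutCapacity_extendCut h, contCutCapacity_eq h hS.1.2] at hval
  -- The averaging lemma is stated for upper bounds, so it is applied to negated capacities.
  have := ae_eq_of_le_of_integral_ge (intervalIntegrable_discCutCapacity h hS.1.2).neg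
    (A := - N.discCutCapacity S₀)
    (ae_of_all _ fun θ hθ => neg_le_neg (hS₀.2 _ (hS.1.1.shift h hθ)))
    (by
      simp only [Pi.neg_apply, intervalIntegral.integral_neg]
      exact neg_le_neg hval)
  filter_upwards [this] with θ h2 hθ
  exact ⟨hS.1.1.shift h hθ, fun S' hS' => (neg_injective (h2 hθ)).le.trans (hS₀.2 S' hS')⟩

end Cut

/-! ### Comparison of complexities -/

theorem exists_mem_Ioo_of_ae {P : ℝ → Prop} (hP : ∀ᵐ θ : ℝ, θ ∈ Ioo (0 : ℝ) 1 → P θ) :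
    ∃ θ ∈ Ioo (0 : ℝ) 1, P θ := by
  have : (ae (volume.restrict (Ioo (0 : ℝ) 1))).NeBot := by
    rw [ae_neBot, Ne, Measure.restrict_eq_zero]
    simp
  obtain ⟨θ, h1, h2⟩ := (((ae_restrict_iff' measurableSet_Ioo).2 hP).and
    (ae_restrict_mem measurableSet_Ioo)).exists
  exact ⟨θ, h2, h1⟩

theorem ae_discChanges_le_contChanges {α : Type*} {g : ℝ → α} {D : ℤ}
    (hg : IsPiecewiseConstant g (D + 1)) :
    ∀ᵐ θ : ℝ, θ ∈ Ioo (0 : ℝ) 1 →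
      discChanges (fun k : ℤ => g (θ + k)) D ≤ contChanges g (D + 1) := by
  obtain ⟨F, hF, hgF⟩ := hg
  filter_upwards [ae_shift_notMem_of_finite hF] with θ hθF hθ
  exact discChanges_le_contChanges hF hgF hθ hθF

theorem contCapacityChanges_eq (h : N.IsContExtension M) :
    M.contCapacityChanges = N.discCapacityChanges := by
  unfold contCapacityChanges discCapacityChanges
  rw [h.edges, h.horizon]
  refine Finset.sum_congr rfl fun e _ => ?_
  rw [← contChanges_comp_floor]
  congr 1
  exact funext (h.cap e)

theorem le_contCutComplexity [Fintype V] (h : N.IsContExtension M) {b : ℕ∞}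
    (hmin : ∃ S, N.IsDiscMinCut S) (hb : ∀ S, N.IsDiscMinCut S → b ≤ N.discCutComplexity S)
    {S : V → ℝ → Bool} (hS : M.IsContMinCut S) (hpc : M.IsPiecewiseConstantCut S) :
    b ≤ M.contCutComplexity S := by
  obtain ⟨S₀, hS₀⟩ := hmin
  have h1 : ∀ᵐ θ : ℝ, ∀ v, θ ∈ Ioo (0 : ℝ) 1 →
      discChanges (fun k : ℤ => S v (θ + k)) N.horizon ≤ contChanges (S v) (N.horizon + 1) :=
    ae_all_iff.2 fun v => ae_discChanges_le_contChanges (h.horizon ▸ hpc v)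
  -- A single offset must serve both purposes: the sample is a minimum cut, and for each of the
  -- finitely many vertices it changes no more often than the original.
  obtain ⟨θ, -, hmin, hle⟩ := exists_mem_Ioo_of_ae
    (P := fun θ => N.IsDiscMinCut (fun v (k : ℤ) => S v (θ + k)) ∧ ∀ v,
      discChanges (fun k : ℤ => S v (θ + k)) N.horizon ≤ contChanges (S v) (N.horizon + 1))
    (by
      filter_upwards [hS.ae_isDiscMinCut h hS₀, h1] with θ h2 h3 hθ
      exact ⟨h2 hθ, fun v => h3 v hθ⟩)
  refine (hb _ hmin).trans (Finset.sum_le_sum fun v _ => ?_)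
  rw [h.horizon]
  exact hle v

theorem le_contFlowComplexity [DecidableEq V] [Finite V] (h : N.IsContExtension M) {b : ℕ∞}
    (hmax : ∃ f, N.IsDiscMaxFlow f) (hb : ∀ f, N.IsDiscMaxFlow f → b ≤ N.discFlowComplexity f)
    {f : V × V → ℝ → ℝ} (hf : M.IsContMaxFlow f) (hpc : M.IsPiecewiseConstantFlow f) :
    b ≤ M.contFlowComplexity f := by
  obtain ⟨g, hg⟩ := hmax
  have hD : ∀ e, M.horizon - M.transit e = ((N.horizon - N.transit e : ℤ) : ℝ) + 1 := by
    intro e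
    rw [h.horizon, h.transit]
    push_cast
    ring
  have h1 : ∀ᵐ θ : ℝ, ∀ e, e ∈ M.edges → θ ∈ Ioo (0 : ℝ) 1 →
      discChanges (fun k : ℤ => f e (θ + k)) (N.horizon - N.transit e) ≤
        contChanges (f e) (M.horizon - M.transit e) := by
    refine ae_all_iff.2 fun e => ?_
    by_cases he : e ∈ M.edges
    · have := hpc e he
      rw [hD] at this ⊢
      exact (ae_discChanges_le_contChanges this).mono fun θ hθ _ => hθ
    · exact ae_of_all _ fun θ h => absurd h he
  obtain ⟨θ, -, hmax, hle⟩ := exists_mem_Ioo_of_ae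
    (P := fun θ => N.IsDiscMaxFlow (fun e (k : ℤ) => f e (θ + k)) ∧ ∀ e ∈ M.edges,
      discChanges (fun k : ℤ => f e (θ + k)) (N.horizon - N.transit e) ≤
        contChanges (f e) (M.horizon - M.transit e))
    (by
      filter_upwards [hf.ae_isDiscMaxFlow h hg, h1] with θ h2 h3 hθ
      exact ⟨h2 hθ, fun e he => h3 e he hθ⟩)
  refine (hb _ hmax).trans ?_
  unfold discFlowComplexity contFlowComplexity
  rw [← h.edges]
  exact Finset.sum_le_sum hle

end DynamicNetwork

/-! ### Continuous-time codes -/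

namespace NetworkCode

/-- The code of the continuous-time network in which every time step of the discrete-time network
has become a unit interval. -/
def toContCode (c : NetworkCode ℕ) : NetworkCode ℚ≥0 where
  n := c.n
  source := c.source
  sink := c.sink
  source_ne_sink := c.source_ne_sink
  edges := c.edges
  initCap := c.initCap
  capSteps e := (c.capSteps e).map fun p => ((p.1 : ℚ≥0), p.2)
  transit e := c.transit e
  horizon := (c.horizon + 1 : ℕ)

theorem stepFun_natCast_floor (l : List (ℕ × ℚ≥0)) (a θ : ℝ) :
    stepFun a (l.map fun p => ((p.1 : ℝ), (p.2 : ℝ))) θ =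
      stepFun a (l.map fun p => ((p.1 : ℤ), (p.2 : ℝ))) ⌊θ⌋ := by
  induction l generalizing a with
  | nil => rfl
  | cons p l ih =>
    simp only [List.map_cons, stepFun, ih]
    congr 1
    rw [Int.le_floor]
    simp

theorem isContExtension_toContCode (c : NetworkCode ℕ) :
    c.toDisc.IsContExtension c.toContCode.toCont where
  source := rfl
  sink := rfl
  edges := rfl
  transit e := by simp [toContCode, toCont, toDisc, toNetwork]
  horizon := by simp [toContCode, toCont, toDisc, toNetwork]
  cap e θ := by
    have := stepFun_natCast_floor (c.capSteps e) (c.initCap e) θ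
    simpa [toContCode, toCont, toDisc, toNetwork, Function.comp_def] using this

theorem nnratBits_natCast (k : ℕ) : nnratBits k = Nat.size k + 1 := by
  simp [nnratBits]

theorem one_le_nnratBits (q : ℚ≥0) : 1 ≤ nnratBits q :=
  le_trans (Nat.size_pos.2 q.den_pos) (Nat.le_add_left _ _)

theorem size_succ_le (k : ℕ) : Nat.size (k + 1) ≤ Nat.size k + 1 := by
  rw [Nat.size_le, pow_succ]
  have := Nat.lt_size_self k
  omega

/-- Reading a natural number as a rational costs one extra bit for the denominator, which doubling
the size absorbs; the `+ 2` pays for the horizon, which also grows by 1. -/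
theorem size_toContCode_le (c : NetworkCode ℕ) :
    c.toContCode.size nnratBits ≤ 2 * c.size Nat.size + 2 := by
  have hlist : ∀ l : List (ℕ × ℚ≥0),
      ((l.map fun p => ((p.1 : ℚ≥0), p.2)).map fun p => nnratBits p.1 + nnratBits p.2).sum ≤
        2 * (l.map fun p => Nat.size p.1 + nnratBits p.2).sum := by
    intro l
    induction l with
    | nil => simp
    | cons p l ih =>
      simp only [List.map_cons, List.sum_cons, nnratBits_natCast] at ih ⊢
      have := one_le_nnratBits p.2
      omega
  have hsum : ∑ e ∈ c.edges, (1 + nnratBits (c.transit e : ℚ≥0) + nnratBits (c.initCap e) +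
      (((c.capSteps e).map fun p => ((p.1 : ℚ≥0), p.2)).map
        fun p => nnratBits p.1 + nnratBits p.2).sum) ≤
      2 * ∑ e ∈ c.edges, (1 + Nat.size (c.transit e) + nnratBits (c.initCap e) +
      ((c.capSteps e).map fun p => Nat.size p.1 + nnratBits p.2).sum) := by
    rw [Finset.mul_sum]
    refine Finset.sum_le_sum fun e _ => ?_
    have := hlist (c.capSteps e)
    rw [nnratBits_natCast]
    omega
  have hh := size_succ_le c.horizon
  simp only [size, toContCode, nnratBits_natCast] at hsum ⊢
  omega

end NetworkCode

/-! ### The Fibonacci network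

The inner vertices `1, …, m` are joined by edges `(x, x + 1)` and `(x, x + 2)`. The transit times
are such that a pulse that leaves the source `0` at time `0` can reach `x` exactly at the even times
below `2 * fib x`. Only the edge from `m` to the sink `m + 1` is a bottleneck. -/

/-- The code of the Fibonacci network with `m` inner vertices. -/
def fibonacciCode (m : ℕ) : NetworkCode ℕ where
  n := m + 2
  source := 0
  sink := Fin.last (m + 1)
  source_ne_sink := (Fin.last_pos).ne
  edges := Finset.univ.filter fun e =>
    (e.2 : ℕ) = e.1 + 1 ∨ ((e.2 : ℕ) = e.1 + 2 ∧ 0 < (e.1 : ℕ) ∧ (e.2 : ℕ) ≤ m)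
  initCap e := if (e.1 : ℕ) = m then 1 else Nat.fib m + 1
  capSteps e := if (e.1 : ℕ) = 0 then [(1, 0)] else []
  transit e := if (e.2 : ℕ) = e.1 + 1 then 0 else 2 * Nat.fib (e.1 + 1)
  horizon := 2 * Nat.fib m

/-- The discrete-time Fibonacci network. -/
noncomputable def fibonacciNetwork (m : ℕ) : DynamicNetwork ℤ (Fin (m + 2)) :=
  (fibonacciCode m).toDisc

/-- The pulse can be at vertex `x` at time `θ`. -/
def FibActive (x : ℕ) (θ : ℤ) : Prop := Even θ ∧ 0 ≤ θ ∧ θ < 2 * Nat.fib (max x 1)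

instance (x : ℕ) (θ : ℤ) : Decidable (FibActive x θ) := inferInstanceAs (Decidable (_ ∧ _ ∧ _))

namespace fibonacciNetwork

open DynamicNetwork

variable {m : ℕ}

/-! ### Data of the Fibonacci network -/

theorem source_eq : (fibonacciNetwork m).source = 0 := rfl

theorem sink_eq : (fibonacciNetwork m).sink = Fin.last (m + 1) := rfl

theorem horizon_eq : (fibonacciNetwork m).horizon = 2 * Nat.fib m := by
  simp [fibonacciNetwork, fibonacciCode, NetworkCode.toDisc, NetworkCode.toNetwork]

theorem mem_edges {e : Fin (m + 2) × Fin (m + 2)} : e ∈ (fibonacciNetwork m).edges ↔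
    (e.2 : ℕ) = e.1 + 1 ∨ ((e.2 : ℕ) = e.1 + 2 ∧ 0 < (e.1 : ℕ) ∧ (e.2 : ℕ) ≤ m) := by
  simp [fibonacciNetwork, fibonacciCode, NetworkCode.toDisc, NetworkCode.toNetwork]

theorem transit_eq (e : Fin (m + 2) × Fin (m + 2)) : (fibonacciNetwork m).transit e =
    if (e.2 : ℕ) = e.1 + 1 then 0 else 2 * (Nat.fib (e.1 + 1) : ℤ) := by
  simp [fibonacciNetwork, fibonacciCode, NetworkCode.toDisc, NetworkCode.toNetwork]

theorem cap_eq (hm : 0 < m) (e : Fin (m + 2) × Fin (m + 2)) (θ : ℤ) :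
    (fibonacciNetwork m).cap e θ =
      if (e.1 : ℕ) = m then 1 else if (e.1 : ℕ) = 0 ∧ 1 ≤ θ then 0 else (Nat.fib m + 1 : ℝ) := by
  simp only [fibonacciNetwork, fibonacciCode, NetworkCode.toDisc, NetworkCode.toNetwork]
  by_cases h1 : (e.1 : ℕ) = m
  · have h0 : (e.1 : ℕ) ≠ 0 := by omega
    simp [h1, hm.ne', stepFun]
  · by_cases h0 : (e.1 : ℕ) = 0 <;> simp [h0, h1, hm.ne, stepFun]

theorem isAcyclic : (fibonacciNetwork m).IsAcyclic := by
  intro v hv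
  have : ∀ a b, Relation.TransGen (fun a b => (a, b) ∈ (fibonacciNetwork m).edges) a b →
      a < b := by
    intro a b h
    induction h with
    | single h =>
      have := mem_edges.1 h
      simp only at this
      exact Fin.lt_def.2 (by omega)
    | tail _ h ih =>
      have := mem_edges.1 h
      simp only at this
      exact ih.trans (Fin.lt_def.2 (by omega))
  exact lt_irrefl _ (this v v hv)

theorem discCapacityChanges_eq (hm : 0 < m) : (fibonacciNetwork m).discCapacityChanges = 1 := by
  unfold discCapacityChanges
  have hfib : 0 < Nat.fib m := Nat.fib_pos.2 hm
  rw [Finset.sum_eq_single (⟨0, by omega⟩, ⟨1, by omega⟩)]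
  · have : {θ : ℤ | θ ∈ Ioc 0 (fibonacciNetwork m).horizon ∧
        (fibonacciNetwork m).cap (⟨0, by omega⟩, ⟨1, by omega⟩) (θ - 1) ≠
          (fibonacciNetwork m).cap (⟨0, by omega⟩, ⟨1, by omega⟩) θ} = {1} := by
      ext θ
      simp only [mem_ofPred_eq, mem_Ioc, horizon_eq, cap_eq hm, mem_singleton_iff]
      rw [if_neg hm.ne, if_neg hm.ne]
      constructor
      · rintro ⟨⟨h1, h2⟩, h3⟩
        by_contra hne
        exact h3 (by rw [if_pos ⟨trivial, by omega⟩, if_pos ⟨trivial, by omega⟩])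
      · rintro rfl
        refine ⟨by omega, ?_⟩
        rw [if_neg (by simp), if_pos (by simp)]
        positivity
    rw [discChanges, this, encard_singleton]
  · intro e he hne
    have he := mem_edges.1 he
    have h0 : (e.1 : ℕ) ≠ 0 := by
      intro h0
      apply hne
      ext <;> simp only <;> omega
    rw [discChanges, encard_eq_zero, eq_empty_iff_forall_notMem]
    rintro θ ⟨-, h⟩
    simp [cap_eq hm, h0] at h
  · intro h
    exact absurd (mem_edges.2 (Or.inl rfl)) h

/-! ### Propagation of the pulse -/

theorem fibActive_of_edge {e : Fin (m + 2) × Fin (m + 2)} (he : e ∈ (fibonacciNetwork m).edges)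
    {θ : ℤ} (h : FibActive e.1 θ) : FibActive e.2 (θ + (fibonacciNetwork m).transit e) := by
  rw [transit_eq]
  obtain ⟨h0, h1, h2⟩ := h
  rcases mem_edges.1 he with h | ⟨h, h', -⟩
  · rw [if_pos h, h, add_zero]
    refine ⟨h0, h1, h2.trans_le ?_⟩
    have := Nat.fib_mono (show max (e.1 : ℕ) 1 ≤ max (e.1 + 1 : ℕ) 1 by omega)
    omega
  · rw [if_neg (by omega), h]
    rw [max_eq_left (by omega)] at h2
    refine ⟨h0.add (even_two_mul _), by omega, ?_⟩
    rw [max_eq_left (by omega), Nat.fib_add_two]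
    push_cast
    omega

/-- Active times of `y` below `2 * fib (y - 1)` come from `y - 1` without delay; the later ones come
from `y - 2` after the delay `2 * fib (y - 1)`. For `y = 1, 2` only the first case occurs. The `max`
in `FibActive` makes the source active at time 0 although `fib 0 = 0`. -/
theorem exists_edge_of_fibActive {y : Fin (m + 2)} (hy : 0 < (y : ℕ)) (hym : (y : ℕ) ≤ m) {θ : ℤ}
    (h : FibActive y θ) : ∃ e ∈ (fibonacciNetwork m).edges, e.2 = y ∧ (e.1 : ℕ) < y ∧
      FibActive e.1 (θ - (fibonacciNetwork m).transit e) := by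
  obtain ⟨h0, h1, h2⟩ := h
  rw [max_eq_left (by omega)] at h2
  by_cases hc : θ < 2 * Nat.fib (max (y - 1 : ℕ) 1)
  · refine ⟨(⟨y - 1, by omega⟩, y), mem_edges.2 (Or.inl ?_), rfl, ?_, ?_⟩
    · simp only; omega
    · simp only; omega
    · rw [transit_eq, if_pos (by simp only; omega), sub_zero]
      exact ⟨h0, h1, hc⟩
  · have hy3 : 3 ≤ (y : ℕ) := by
      by_contra hlt
      apply hc
      have : (y : ℕ) = 1 ∨ (y : ℕ) = 2 := by omega
      rcases this with h | h <;> simpa [h] using h2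
    rw [max_eq_left (by omega)] at hc
    obtain ⟨k, hk⟩ : ∃ k, (y : ℕ) = k + 2 := ⟨y - 2, by omega⟩
    rw [hk, Nat.fib_add_two] at h2
    have hk1 : (y : ℕ) - 1 = k + 1 := by omega
    rw [hk1] at hc
    refine ⟨(⟨k, by omega⟩, y), mem_edges.2 (Or.inr ?_), rfl, ?_, ?_⟩
    · simp only; omega
    · simp only; omega
    · rw [transit_eq, if_neg (by simp only; omega)]
      refine ⟨h0.sub (even_two_mul _), ?_, ?_⟩
      · simp only; omega
      · simp only
        rw [max_eq_left (by omega)]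
        push_cast at h2
        omega

theorem FibActive.lt_horizon {x : ℕ} {θ : ℤ} (h : FibActive x θ) (hm : 0 < m) (hx : x ≤ m) :
    θ < (fibonacciNetwork m).horizon := by
  rw [horizon_eq]
  have := Nat.fib_mono (show max x 1 ≤ m by omega)
  have := h.2.2
  omega

theorem sum_fibActive (hm : 0 < m) :
    ∑ θ ∈ Finset.Icc 0 (fibonacciNetwork m).horizon, (if FibActive m θ then (1 : ℝ) else 0) =
      Nat.fib m := by
  rw [← Finset.sum_filter, Finset.sum_const, nsmul_eq_mul, mul_one, horizon_eq]
  congr 1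
  conv_rhs => rw [← Finset.card_range (Nat.fib m)]
  symm
  refine Finset.card_bij (fun j _ => 2 * (j : ℤ)) ?_ ?_ ?_
  · intro j hj
    rw [Finset.mem_range] at hj
    refine Finset.mem_filter.2 ⟨Finset.mem_Icc.2 ⟨by omega, by omega⟩, even_two_mul _, by omega, ?_⟩
    rw [max_eq_left (by omega)]
    omega
  · intro a _ b _ h
    omega
  · intro θ hθ
    obtain ⟨⟨r, hr⟩, h1, h2⟩ := (Finset.mem_filter.1 hθ).2
    rw [max_eq_left (by omega)] at h2
    exact ⟨r.toNat, Finset.mem_range.2 (by omega), by omega⟩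

theorem fib_le_discChanges {α : Type*} {g : ℤ → α} {a b : α} (hab : a ≠ b) (hm : 0 < m)
    (hg : ∀ θ ∈ Finset.Icc 0 (fibonacciNetwork m).horizon, g θ = if FibActive m θ then a else b) :
    (Nat.fib m : ℕ∞) ≤ discChanges g (fibonacciNetwork m).horizon := by
  rw [horizon_eq] at hg ⊢
  -- Every odd time below the horizon is inactive and follows an active even time.
  have hsub : (fun j : ℕ => 2 * (j : ℤ) + 1) '' (Finset.range (Nat.fib m) : Set ℕ) ⊆
      {θ : ℤ | θ ∈ Ioc 0 (2 * (Nat.fib m : ℤ)) ∧ g (θ - 1) ≠ g θ} := by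
    rintro _ ⟨j, hj, rfl⟩
    have hj : j < Nat.fib m := by simpa using hj
    beta_reduce
    refine ⟨⟨by omega, by omega⟩, ?_⟩
    rw [hg _ (Finset.mem_Icc.2 ⟨by omega, by omega⟩), hg _ (Finset.mem_Icc.2 ⟨by omega, by omega⟩),
      if_pos, if_neg]
    · exact hab
    · rintro ⟨⟨r, hr⟩, -⟩
      omega
    · refine ⟨by simp, by omega, ?_⟩
      rw [max_eq_left (by omega)]
      omega
  refine le_trans ?_ (encard_le_encard hsub)
  rw [InjOn.encard_image, encard_coe_eq_coe_finsetCard, Finset.card_range]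
  intro a _ b _ h
  simpa using h

/-! #### Flows -/

/-- The edge from the last inner vertex to the sink. -/
def lastEdge (m : ℕ) : Fin (m + 2) × Fin (m + 2) := (⟨m, by omega⟩, Fin.last (m + 1))

theorem lastEdge_mem : lastEdge m ∈ (fibonacciNetwork m).edges := mem_edges.2 (Or.inl rfl)

theorem transit_lastEdge : (fibonacciNetwork m).transit (lastEdge m) = 0 := by
  rw [transit_eq, if_pos (show ((lastEdge m).2 : ℕ) = (lastEdge m).1 + 1 from rfl)]

theorem cap_lastEdge (hm : 0 < m) (θ : ℤ) : (fibonacciNetwork m).cap (lastEdge m) θ = 1 := by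
  rw [cap_eq hm, if_pos (show ((lastEdge m).1 : ℕ) = m from rfl)]

theorem eq_lastEdge_of_snd {e : Fin (m + 2) × Fin (m + 2)} (he : e ∈ (fibonacciNetwork m).edges)
    (h : e.2 = Fin.last (m + 1)) : e = lastEdge m := by
  have he := mem_edges.1 he
  have h' := congrArg Fin.val h
  simp only [Fin.val_last] at h'
  unfold lastEdge
  ext <;> simp only [Fin.val_last] <;> omega

theorem fst_le {e : Fin (m + 2) × Fin (m + 2)} (he : e ∈ (fibonacciNetwork m).edges) :
    (e.1 : ℕ) ≤ m := by
  have he := mem_edges.1 he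
  omega

theorem netInflow_sink (f : Fin (m + 2) × Fin (m + 2) → ℤ → ℝ) (θ : ℤ) :
    (fibonacciNetwork m).netInflow f (fibonacciNetwork m).sink θ = f (lastEdge m) θ := by
  unfold netInflow
  rw [Finset.sum_eq_single (lastEdge m), Finset.sum_eq_zero, transit_lastEdge, sub_zero, sub_zero]
  · intro e he
    obtain ⟨he, h⟩ := Finset.mem_filter.1 he
    have h1 := fst_le he
    have h2 := congrArg Fin.val h
    simp only [sink_eq, Fin.val_last] at h2
    omega
  · intro e he hne
    obtain ⟨he, h⟩ := Finset.mem_filter.1 he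
    exact absurd (eq_lastEdge_of_snd he h) hne
  · intro h
    exact (h (Finset.mem_filter.2 ⟨lastEdge_mem, sink_eq.symm⟩)).elim

theorem discFlowValue_eq (f : Fin (m + 2) × Fin (m + 2) → ℤ → ℝ) :
    (fibonacciNetwork m).discFlowValue f =
      ∑ θ ∈ Finset.Icc 0 (fibonacciNetwork m).horizon, f (lastEdge m) θ := by
  simp only [discFlowValue, discExcess, netInflow_sink]

/-- Induction on the tail: the source edge is closed from time 1 on, and an inner vertex that is
inactive at `θ` has only inactive predecessors at the matching departure times. Its inflow is
therefore 0, and so is its nonnegative outflow. -/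
theorem flow_eq_zero_of_not_fibActive (hm : 0 < m) {f : Fin (m + 2) × Fin (m + 2) → ℤ → ℝ}
    (hf : (fibonacciNetwork m).IsDiscFlow f) {e : Fin (m + 2) × Fin (m + 2)}
    (he : e ∈ (fibonacciNetwork m).edges) {θ : ℤ} (h : ¬ FibActive e.1 θ) : f e θ = 0 := by
  have hnn : ∀ e ∈ (fibonacciNetwork m).edges, ∀ θ, 0 ≤ f e θ := by
    intro e he θ
    by_cases hθ : θ ∈ Icc 0 ((fibonacciNetwork m).horizon - (fibonacciNetwork m).transit e)
    · exact hf.feasible.nonneg e he θ hθ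
    · exact (hf.feasible.eq_zero e he θ hθ).ge
  obtain ⟨x, hx⟩ : ∃ x, (e.1 : ℕ) = x := ⟨_, rfl⟩
  induction x using Nat.strong_induction_on generalizing e θ with
  | _ x ih =>
  by_cases hθ : θ ∈ Icc 0 ((fibonacciNetwork m).horizon - (fibonacciNetwork m).transit e)
  swap
  · exact hf.feasible.eq_zero e he θ hθ
  rcases Nat.eq_zero_or_pos x with rfl | hpos
  · refine le_antisymm ((hf.feasible.le_cap e he θ hθ).trans ?_) (hnn e he θ)
    have h1 : 1 ≤ θ := by
      by_contra hlt
      have h0 : θ = 0 := le_antisymm (by omega) hθ.1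
      exact h ⟨by simp [h0], by omega, by simp [hx, h0]⟩
    rw [cap_eq hm, if_neg (by omega), if_pos ⟨hx, h1⟩]
  · have hxm := fst_le he
    have hnet := hf.netInflow_eq_zero (v := e.1)
      (by rw [source_eq]; intro h; rw [h] at hx; simp at hx; omega)
      (by rw [sink_eq]; intro h; rw [h] at hx hxm; simp at hx hxm) θ
    unfold netInflow at hnet
    rw [Finset.sum_eq_zero, zero_sub, neg_eq_zero, Finset.sum_eq_zero_iff_of_nonneg] at hnet
    · exact hnet e (Finset.mem_filter.2 ⟨he, rfl⟩)
    · intro e' he'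
      exact hnn e' (Finset.mem_filter.1 he').1 θ
    · intro e' he'
      obtain ⟨he', heq⟩ := Finset.mem_filter.1 he'
      have hlt : (e'.1 : ℕ) < e'.2 := by
        have := mem_edges.1 he'
        omega
      refine ih _ (by rw [← hx, ← heq]; exact hlt) he' (fun hact => h ?_) rfl
      have := fibActive_of_edge he' hact
      rwa [sub_add_cancel, heq] at this

theorem flow_lastEdge_le (hm : 0 < m) {f : Fin (m + 2) × Fin (m + 2) → ℤ → ℝ}
    (hf : (fibonacciNetwork m).IsDiscFlow f) {θ : ℤ}
    (hθ : θ ∈ Finset.Icc 0 (fibonacciNetwork m).horizon) :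
    f (lastEdge m) θ ≤ if FibActive m θ then 1 else 0 := by
  split_ifs with h
  · have := hf.feasible.le_cap _ lastEdge_mem θ
      (by rw [transit_lastEdge, sub_zero]; exact Finset.mem_Icc.1 hθ)
    rwa [cap_lastEdge hm] at this
  · exact (flow_eq_zero_of_not_fibActive hm hf lastEdge_mem h).le

theorem discFlowValue_le (hm : 0 < m) {f : Fin (m + 2) × Fin (m + 2) → ℤ → ℝ}
    (hf : (fibonacciNetwork m).IsDiscFlow f) :
    (fibonacciNetwork m).discFlowValue f ≤ Nat.fib m := by
  rw [discFlowValue_eq, ← sum_fibActive hm]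
  exact Finset.sum_le_sum fun θ hθ => flow_lastEdge_le hm hf hθ

/-- Number of paths from `y` to the sink. -/
def pathCount (m y : ℕ) : ℕ := if y = m + 1 then 1 else Nat.fib (m + 1 - y)

/-- The flow in which the pulse follows every path from vertex `1` to the sink once. -/
noncomputable def pulseFlow (m : ℕ) (e : Fin (m + 2) × Fin (m + 2)) (θ : ℤ) : ℝ :=
  if FibActive e.1 θ then pathCount m e.2 else 0

theorem sum_out (f : Fin (m + 2) → ℝ) {v : Fin (m + 2)} (hv : 0 < (v : ℕ)) (hvm : (v : ℕ) ≤ m) :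
    ∑ e ∈ (fibonacciNetwork m).edges with e.1 = v, f e.2 = f ⟨v + 1, by omega⟩ +
      if h : (v : ℕ) + 2 ≤ m then f ⟨v + 2, by omega⟩ else 0 := by
  split_ifs with h
  · have : ((fibonacciNetwork m).edges.filter fun e => e.1 = v) =
        {(v, ⟨v + 1, by omega⟩), (v, ⟨v + 2, by omega⟩)} := by
      ext ⟨a, b⟩
      simp only [Finset.mem_filter, mem_edges, Finset.mem_insert, Finset.mem_singleton,
        Prod.mk.injEq, Fin.ext_iff]
      omega
    rw [this, Finset.sum_pair]
    simp
  · have : ((fibonacciNetwork m).edges.filter fun e => e.1 = v) = {(v, ⟨v + 1, by omega⟩)} := by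
      ext ⟨a, b⟩
      simp only [Finset.mem_filter, mem_edges, Finset.mem_singleton,
        Prod.mk.injEq, Fin.ext_iff]
      omega
    rw [this, Finset.sum_singleton, add_zero]

/-- Paths are sorted by their first edge; this is the Fibonacci recursion read backwards from `m`,
and it becomes conservation for `pulseFlow`. -/
theorem pathCount_add (v : ℕ) (hvm : v ≤ m) :
    (pathCount m (v + 1) + if v + 2 ≤ m then pathCount m (v + 2) else 0) = pathCount m v := by
  unfold pathCount
  rcases Nat.lt_or_ge m (v + 2) with h | h
  · have : m = v ∨ m = v + 1 := by omega
    rcases this with rfl | rfl <;> simp [show ∀ k, k + 1 + 1 - k = 2 by omega]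
  · obtain ⟨k, rfl⟩ := Nat.exists_eq_add_of_le h
    rw [if_neg (by omega), if_pos h, if_neg (by omega), if_neg (by omega),
      show v + 2 + k + 1 - v = (k + 1) + 2 by omega, Nat.fib_add_two, add_comm]
    congr 2 <;> omega

/-- At an active time exactly one incoming edge delivers the pulse, because the two blocks of
arrival times are disjoint. -/
theorem sum_in_fibActive {v : Fin (m + 2)} (hv : 0 < (v : ℕ)) (hvm : (v : ℕ) ≤ m) (θ : ℤ) (c : ℝ) :
    ∑ e ∈ (fibonacciNetwork m).edges with e.2 = v,
      (if FibActive e.1 (θ - (fibonacciNetwork m).transit e) then c else 0) =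
      if FibActive v θ then c else 0 := by
  split_ifs with h
  · obtain ⟨e, he, hev, hlt, hact⟩ := exists_edge_of_fibActive hv hvm h
    rw [Finset.sum_eq_single e, if_pos hact]
    · intro e' he' hne
      obtain ⟨he', hev'⟩ := Finset.mem_filter.1 he'
      rw [if_neg]
      intro hact'
      have h1 : (e.1 : ℕ) ≠ e'.1 := fun h => hne (Prod.ext (Fin.ext h.symm) (hev'.trans hev.symm))
      -- The delayed edge delivers no earlier than `2 * fib (v - 1)`, the direct one strictly before
      -- that time.
      have key : ∀ e₁ ∈ (fibonacciNetwork m).edges, ∀ e₂ ∈ (fibonacciNetwork m).edges,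
          e₁.2 = v → e₂.2 = v → (e₁.1 : ℕ) < e₂.1 →
          FibActive e₁.1 (θ - (fibonacciNetwork m).transit e₁) →
          FibActive e₂.1 (θ - (fibonacciNetwork m).transit e₂) → False := by
        intro e₁ he₁ e₂ he₂ hv₁ hv₂ hlt ha₁ ha₂
        have he₁ := mem_edges.1 he₁
        have he₂ := mem_edges.1 he₂
        have hv₁ := congrArg Fin.val hv₁
        have hv₂ := congrArg Fin.val hv₂
        have h1 := ha₁.2.1
        have h2 := ha₂.2.2
        rw [transit_eq, if_neg (by omega)] at h1
        rw [transit_eq, if_pos (by omega), max_eq_left (by omega),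
          show (e₂.1 : ℕ) = e₁.1 + 1 by omega] at h2
        omega
      rcases lt_or_gt_of_ne h1 with h1 | h1
      · exact key e he e' he' hev hev' h1 hact hact'
      · exact key e' he' e he hev' hev h1 hact' hact
    · intro hn
      exact absurd (Finset.mem_filter.2 ⟨he, hev⟩) hn
  · refine Finset.sum_eq_zero fun e he => if_neg fun hact => h ?_
    obtain ⟨he, hev⟩ := Finset.mem_filter.1 he
    have := fibActive_of_edge he hact
    rwa [sub_add_cancel, hev] at this

theorem netInflow_pulseFlow {v : Fin (m + 2)} (hv : 0 < (v : ℕ)) (hvm : (v : ℕ) ≤ m) (θ : ℤ) :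
    (fibonacciNetwork m).netInflow (pulseFlow m) v θ = 0 := by
  unfold netInflow
  have hin : ∑ e ∈ (fibonacciNetwork m).edges with e.2 = v,
      pulseFlow m e (θ - (fibonacciNetwork m).transit e) =
      if FibActive v θ then (pathCount m v : ℝ) else 0 := by
    rw [← sum_in_fibActive hv hvm]
    refine Finset.sum_congr rfl fun e he => ?_
    rw [pulseFlow, (Finset.mem_filter.1 he).2]
  have hout : ∑ e ∈ (fibonacciNetwork m).edges with e.1 = v, pulseFlow m e θ =
      if FibActive v θ then (pathCount m v : ℝ) else 0 := by
    have : ∑ e ∈ (fibonacciNetwork m).edges with e.1 = v, pulseFlow m e θ =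
        ∑ e ∈ (fibonacciNetwork m).edges with e.1 = v,
          if FibActive v θ then (pathCount m e.2 : ℝ) else 0 :=
      Finset.sum_congr rfl fun e he => by rw [pulseFlow, (Finset.mem_filter.1 he).2]
    rw [this, sum_out (fun y => if FibActive v θ then (pathCount m y : ℝ) else 0) hv hvm,
      ← pathCount_add v hvm]
    split_ifs <;> simp
  rw [hin, hout, sub_self]

theorem isDiscFlow_pulseFlow (hm : 0 < m) : (fibonacciNetwork m).IsDiscFlow (pulseFlow m) := by
  refine ⟨⟨?_, ?_, ?_⟩, ?_⟩
  · intro e he θ hθ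
    refine if_neg fun hact => hθ ⟨hact.2.1, ?_⟩
    have h1 := fibActive_of_edge he hact
    by_cases h : (e.2 : ℕ) ≤ m
    · have := FibActive.lt_horizon h1 hm h
      omega
    · have : (fibonacciNetwork m).transit e = 0 := by
        rw [transit_eq, if_pos]
        have := mem_edges.1 he
        omega
      have := FibActive.lt_horizon hact hm (fst_le he)
      omega
  · intro e he θ _
    unfold pulseFlow
    split_ifs <;> positivity
  · intro e he θ _
    have hedge := mem_edges.1 he
    have hle : pathCount m e.2 ≤ Nat.fib m + 1 := by
      unfold pathCount
      split_ifs
      · omega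
      · exact (Nat.fib_mono (by omega)).trans (Nat.le_succ _)
    rw [cap_eq hm]
    unfold pulseFlow
    split_ifs with h1 h2 h3 h2 h3
    · have : (e.2 : ℕ) = m + 1 := by omega
      simp [pathCount, this]
    -- An active time of the source is even and below 2, so it cannot be in the closed phase.
    · exfalso
      obtain ⟨⟨r, hr⟩, -, hlt⟩ := h1
      simp [h3.1] at hlt
      omega
    · exact_mod_cast hle
    · positivity
    · positivity
    · positivity
  · intro v hs ht θ _
    refine Finset.sum_eq_zero fun ζ _ => netInflow_pulseFlow ?_ ?_ ζ
    · exact Nat.pos_of_ne_zero fun h => hs (Fin.ext h)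
    · have : (v : ℕ) ≠ m + 1 := fun h => ht (Fin.ext h)
      omega

theorem discFlowValue_pulseFlow (hm : 0 < m) :
    (fibonacciNetwork m).discFlowValue (pulseFlow m) = Nat.fib m := by
  rw [discFlowValue_eq, ← sum_fibActive hm]
  refine Finset.sum_congr rfl fun θ _ => ?_
  simp [pulseFlow, lastEdge, pathCount]

theorem isDiscMaxFlow_pulseFlow (hm : 0 < m) :
    (fibonacciNetwork m).IsDiscMaxFlow (pulseFlow m) :=
  ⟨isDiscFlow_pulseFlow hm, fun f' hf' => by
    rw [discFlowValue_pulseFlow hm]; exact discFlowValue_le hm hf'⟩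

theorem le_discFlowComplexity (hm : 0 < m) {f : Fin (m + 2) × Fin (m + 2) → ℤ → ℝ}
    (hf : (fibonacciNetwork m).IsDiscMaxFlow f) :
    (Nat.fib m : ℕ∞) ≤ (fibonacciNetwork m).discFlowComplexity f := by
  have hval : (fibonacciNetwork m).discFlowValue f = Nat.fib m :=
    le_antisymm (discFlowValue_le hm hf.1)
      ((discFlowValue_pulseFlow hm).ge.trans (hf.2 _ (isDiscFlow_pulseFlow hm)))
  -- A termwise inequality with equal sums is a termwise equality, so the flow on the last edge is
  -- determined at every time step.
  rw [discFlowValue_eq, ← sum_fibActive hm,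
    Finset.sum_eq_sum_iff_of_le fun θ hθ => flow_lastEdge_le hm hf.1 hθ] at hval
  have h1 := fib_le_discChanges one_ne_zero hm hval
  have h2 := Finset.single_le_sum
    (f := fun e => discChanges (f e)
      ((fibonacciNetwork m).horizon - (fibonacciNetwork m).transit e))
    (fun _ _ => zero_le) (lastEdge_mem (m := m))
  simp only [transit_lastEdge, sub_zero] at h2
  exact h1.trans h2

/-! #### Cuts -/

/-- The cut that follows the pulse. -/
def pulseCut (m : ℕ) (v : Fin (m + 2)) (θ : ℤ) : Bool :=
  decide (2 * (Nat.fib m : ℤ) < θ ∨ v = 0 ∨ (v ≠ Fin.last (m + 1) ∧ FibActive v θ))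

theorem isCut_pulseCut : (fibonacciNetwork m).IsCut (pulseCut m) := by
  refine ⟨fun θ _ => ?_, fun θ hθ => ?_, fun v θ hθ => ?_⟩
  · simp [pulseCut, source_eq]
  · have := hθ.2
    rw [horizon_eq] at this
    have h0 : Fin.last (m + 1) ≠ 0 := Fin.last_pos.ne'
    simp [pulseCut, sink_eq, h0, this]
  · rw [horizon_eq] at hθ
    simp [pulseCut, hθ]

theorem cutRate_pulseCut (hm : 0 < m) {θ : ℤ}
    (hθ : θ ∈ Finset.Icc 0 (fibonacciNetwork m).horizon) :
    (fibonacciNetwork m).cutRate (pulseCut m) θ = if FibActive m θ then 1 else 0 := by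
  have hθ' := Finset.mem_Icc.1 hθ
  unfold cutRate
  rw [Finset.sum_filter, Finset.sum_eq_single (lastEdge m)]
  · have h1 : pulseCut m (lastEdge m).2 (θ + (fibonacciNetwork m).transit (lastEdge m)) = false := by
      rw [transit_lastEdge, add_zero]
      exact isCut_pulseCut.sink_notMem θ hθ'
    have h2 : pulseCut m (lastEdge m).1 θ = true ↔ FibActive m θ := by
      rw [horizon_eq] at hθ'
      simp [pulseCut, lastEdge, Fin.ext_iff, hθ'.2, hm.ne']
    simp only [h1, h2, cap_lastEdge hm, and_true]
  · intro e he hne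
    split_ifs with hc
    swap
    · rfl
    obtain ⟨hc1, hc2⟩ := hc
    have hedge := mem_edges.1 he
    have hlast : e.2 ≠ Fin.last (m + 1) := fun h => hne (eq_lastEdge_of_snd he h)
    have hlast' : e.1 ≠ Fin.last (m + 1) := by
      intro h
      have h1 := fst_le he
      rw [h] at h1
      simp at h1
    -- Activity propagates along edges, so an edge with active tail and head other than the sink is
    -- not cut. The only remaining tail on the source side is the source at an inactive time, when
    -- its edge is closed and costs nothing.
    have hnact : ¬ FibActive e.1 θ := by
      intro hact
      have := fibActive_of_edge he hact
      simp [pulseCut, hlast, this] at hc2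
    rw [horizon_eq] at hθ'
    have h0 : e.1 = 0 := by
      simpa [pulseCut, hθ'.2.not_gt, hnact] using hc1
    have h0' : (e.1 : ℕ) = 0 := by rw [h0]; rfl
    have h1 : 1 ≤ θ := by
      by_contra hlt
      have h0 : θ = 0 := by omega
      exact hnact ⟨by simp [h0], by omega, by simp [h0', h0]⟩
    rw [cap_eq hm, if_neg (by omega), if_pos ⟨h0', h1⟩]
  · exact fun h => absurd lastEdge_mem h

theorem discCutCapacity_pulseCut (hm : 0 < m) :
    (fibonacciNetwork m).discCutCapacity (pulseCut m) = Nat.fib m := by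
  rw [← sum_fibActive hm]
  exact Finset.sum_congr rfl fun θ hθ => cutRate_pulseCut hm hθ

theorem cap_le_cutRate {S : Fin (m + 2) → ℤ → Bool} {e : Fin (m + 2) × Fin (m + 2)}
    (he : e ∈ (fibonacciNetwork m).edges) {θ : ℤ}
    (hθ : θ ∈ Icc 0 (fibonacciNetwork m).horizon)
    (h1 : S e.1 θ = true) (h2 : S e.2 (θ + (fibonacciNetwork m).transit e) = false) :
    (fibonacciNetwork m).cap e θ ≤ (fibonacciNetwork m).cutRate S θ :=
  Finset.single_le_sum (f := fun e => (fibonacciNetwork m).cap e θ)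
    (fun e he => (fibonacciNetwork m).cap_nonneg e (Finset.mem_filter.1 he).1 θ hθ)
    (Finset.mem_filter.2 ⟨he, h1, h2⟩)

theorem cutRate_nonneg {S : Fin (m + 2) → ℤ → Bool} {θ : ℤ}
    (hθ : θ ∈ Icc 0 (fibonacciNetwork m).horizon) : 0 ≤ (fibonacciNetwork m).cutRate S θ :=
  Finset.sum_nonneg fun e he =>
    (fibonacciNetwork m).cap_nonneg e (Finset.mem_filter.1 he).1 θ hθ

/-- Following the pulse forward from the source: the first active vertex on the sink side would have
an open edge of capacity `fib m + 1` cut in front of it, which alone exceeds the assumed total. -/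
theorem cut_eq_true_of_fibActive (hm : 0 < m) {S : Fin (m + 2) → ℤ → Bool}
    (hS : (fibonacciNetwork m).IsCut S)
    (hcap : (fibonacciNetwork m).discCutCapacity S ≤ Nat.fib m) {v : Fin (m + 2)}
    (hvm : (v : ℕ) ≤ m) {θ : ℤ} (h : FibActive v θ) : S v θ = true := by
  obtain ⟨y, hy⟩ : ∃ y, (v : ℕ) = y := ⟨_, rfl⟩
  induction y using Nat.strong_induction_on generalizing v θ with
  | _ y ih =>
  have hdom : ∀ x ≤ m, ∀ ζ, FibActive x ζ → ζ ∈ Icc 0 (fibonacciNetwork m).horizon :=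
    fun x hx ζ hζ => ⟨hζ.2.1, (FibActive.lt_horizon hζ hm hx).le⟩
  rcases Nat.eq_zero_or_pos y with rfl | hpos
  · have hv : v = (fibonacciNetwork m).source := Fin.ext hy
    rw [hv]
    exact hS.source_mem θ (hdom v hvm θ h)
  obtain ⟨e, he, hev, hlt, hact⟩ := exists_edge_of_fibActive (by omega) hvm h
  have hS1 := ih _ (hy ▸ hlt) (fst_le he) hact rfl
  by_contra hfalse
  have hmem := hdom _ (fst_le he) _ hact
  have h1 := cap_le_cutRate he hmem hS1 (by
    rw [sub_add_cancel, hev]; simpa using hfalse)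
  have h2 := Finset.single_le_sum (f := fun ζ => (fibonacciNetwork m).cutRate S ζ)
    (fun ζ hζ => cutRate_nonneg (Finset.mem_Icc.1 hζ)) (Finset.mem_Icc.2 hmem)
  have h3 : (fibonacciNetwork m).cap e (θ - (fibonacciNetwork m).transit e) = Nat.fib m + 1 := by
    rw [cap_eq hm, if_neg (by omega), if_neg]
    rintro ⟨h0, hge⟩
    have h4 := hact.2.2
    have h5 := hact.1
    simp only [h0, zero_le, sup_of_le_right, Nat.fib_one] at h4
    obtain ⟨r, hr⟩ := h5
    push_cast at h4
    omega
  have h4 : (fibonacciNetwork m).cutRate S (θ - (fibonacciNetwork m).transit e) ≤ Nat.fib m :=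
    h2.trans hcap
  linarith

theorem cut_le_cutRate (hm : 0 < m) {S : Fin (m + 2) → ℤ → Bool}
    (hS : (fibonacciNetwork m).IsCut S) {θ : ℤ}
    (hθ : θ ∈ Finset.Icc 0 (fibonacciNetwork m).horizon) :
    (if S (lastEdge m).1 θ = true then (1 : ℝ) else 0) ≤ (fibonacciNetwork m).cutRate S θ := by
  have hθ := Finset.mem_Icc.1 hθ
  split_ifs with h
  · rw [← cap_lastEdge hm θ]
    refine cap_le_cutRate lastEdge_mem hθ h ?_
    rw [transit_lastEdge, add_zero]
    exact hS.sink_notMem θ hθ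
  · exact cutRate_nonneg hθ

theorem fibActive_le_cut (hm : 0 < m) {S : Fin (m + 2) → ℤ → Bool}
    (hS : (fibonacciNetwork m).IsCut S)
    (hcap : (fibonacciNetwork m).discCutCapacity S ≤ Nat.fib m) (θ : ℤ) :
    (if FibActive m θ then (1 : ℝ) else 0) ≤ if S (lastEdge m).1 θ = true then 1 else 0 := by
  by_cases h : FibActive m θ
  · rw [if_pos h, if_pos (cut_eq_true_of_fibActive hm hS hcap le_rfl h)]
  · rw [if_neg h]
    split_ifs <;> norm_num

theorem fib_le_discCutCapacity (hm : 0 < m) {S : Fin (m + 2) → ℤ → Bool}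
    (hS : (fibonacciNetwork m).IsCut S) :
    Nat.fib m ≤ (fibonacciNetwork m).discCutCapacity S := by
  by_contra hlt
  rw [← sum_fibActive hm] at hlt
  refine hlt (Finset.sum_le_sum fun θ hθ => (fibActive_le_cut hm hS ?_ θ).trans
    (cut_le_cutRate hm hS hθ))
  rw [← sum_fibActive hm]
  exact (not_le.1 hlt).le

theorem isDiscMinCut_pulseCut (hm : 0 < m) : (fibonacciNetwork m).IsDiscMinCut (pulseCut m) :=
  ⟨isCut_pulseCut, fun S' hS' => by
    rw [discCutCapacity_pulseCut hm]; exact fib_le_discCutCapacity hm hS'⟩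

theorem le_discCutComplexity (hm : 0 < m) {S : Fin (m + 2) → ℤ → Bool}
    (hS : (fibonacciNetwork m).IsDiscMinCut S) :
    (Nat.fib m : ℕ∞) ≤ (fibonacciNetwork m).discCutComplexity S := by
  have hcap : (fibonacciNetwork m).discCutCapacity S ≤ Nat.fib m :=
    (hS.2 _ isCut_pulseCut).trans (discCutCapacity_pulseCut hm).le
  have hsum : ∑ θ ∈ Finset.Icc 0 (fibonacciNetwork m).horizon,
      (if FibActive m θ then (1 : ℝ) else 0) =
      ∑ θ ∈ Finset.Icc 0 (fibonacciNetwork m).horizon,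
        if S (lastEdge m).1 θ = true then 1 else 0 := by
    -- Activity is bounded by membership of `m` in the source part, and membership by the cut rate.
    -- Both outer sums are pinned to `fib m`, so activity and membership coincide at every time
    -- step.
    refine le_antisymm (Finset.sum_le_sum fun θ _ => fibActive_le_cut hm hS.1 hcap θ) ?_
    rw [sum_fibActive hm]
    exact (Finset.sum_le_sum fun θ hθ => cut_le_cutRate hm hS.1 hθ).trans hcap
  rw [Finset.sum_eq_sum_iff_of_le fun θ _ => fibActive_le_cut hm hS.1 hcap θ] at hsum
  refine (fib_le_discChanges (g := S (lastEdge m).1) (a := true) (b := false) (by simp) hm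
    fun θ hθ => ?_).trans (Finset.single_le_sum
    (f := fun v => discChanges (S v) (fibonacciNetwork m).horizon) (fun _ _ => zero_le)
    (Finset.mem_univ _))
  have := hsum θ hθ
  by_cases h1 : FibActive m θ <;> by_cases h2 : S (lastEdge m).1 θ = true <;>
    simp [h1, h2] at this ⊢

end fibonacciNetwork

/-! ### Growth of Fibonacci numbers and size of the codes -/

theorem two_pow_le_fib (l : ℕ) : 2 ^ l ≤ Nat.fib (2 * l + 1) := by
  induction l with
  | zero => simp
  | succ l ih =>
    rw [show 2 * (l + 1) + 1 = (2 * l + 1) + 2 by ring, Nat.fib_add_two, pow_succ]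
    have := Nat.fib_le_fib_succ (n := 2 * l + 1)
    omega

theorem fib_lt_two_pow (k : ℕ) : Nat.fib k < 2 ^ k := by
  induction k using Nat.twoStepInduction with
  | zero => simp
  | one => simp
  | more k h1 h2 =>
    rw [Nat.fib_add_two]
    simp only [pow_succ] at *
    omega

theorem size_fibonacciCode_le (m : ℕ) :
    (fibonacciCode m).size Nat.size ≤ (m + 2) + (m + 1) + (m + 2) ^ 2 * (2 * m + 14) := by
  have hsize : ∀ k, Nat.size (2 * Nat.fib k) ≤ k + 1 := by
    intro k
    rw [Nat.size_le, pow_succ]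
    have := fib_lt_two_pow k
    omega
  have hterm : ∀ e ∈ (fibonacciCode m).edges, 1 + Nat.size ((fibonacciCode m).transit e) +
      nnratBits ((fibonacciCode m).initCap e) +
      (((fibonacciCode m).capSteps e).map fun p => Nat.size p.1 + nnratBits p.2).sum ≤
      2 * m + 14 := by
    rintro ⟨x, y⟩ -
    have h1 : Nat.size ((fibonacciCode m).transit (x, y)) ≤ m + 3 := by
      simp only [fibonacciCode]
      split_ifs
      · simp
      · exact (hsize _).trans (by have := x.is_lt; simp only [fibonacciCode] at this; omega)
    have h2 : nnratBits ((fibonacciCode m).initCap (x, y)) ≤ m + 3 := by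
      simp only [fibonacciCode]
      split_ifs
      · have := NetworkCode.nnratBits_natCast 1
        simp at this
        omega
      · have h := NetworkCode.nnratBits_natCast (Nat.fib m + 1)
        push_cast at h
        rw [h]
        have : Nat.size (Nat.fib m + 1) ≤ m + 1 := by
          rw [Nat.size_le, pow_succ]
          have := fib_lt_two_pow m
          omega
        omega
    have h3 : (((fibonacciCode m).capSteps (x, y)).map
        fun p => Nat.size p.1 + nnratBits p.2).sum ≤ 2 := by
      simp only [fibonacciCode]
      split_ifs
      · have := NetworkCode.nnratBits_natCast 0
        simp at this
        simp [this]
      · simp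
    omega
  have hsum := Finset.sum_le_card_nsmul _ _ _ hterm
  have hcard : (fibonacciCode m).edges.card ≤ (m + 2) ^ 2 := by
    refine (Finset.card_le_univ _).trans_eq ?_
    rw [Fintype.card_prod, Fintype.card_fin, sq]
    rfl
  rw [smul_eq_mul] at hsum
  have hmul := Nat.mul_le_mul_right (2 * m + 14) hcard
  have hh : Nat.size (fibonacciCode m).horizon ≤ m + 1 := hsize m
  have hn : (fibonacciCode m).n = m + 2 := rfl
  unfold NetworkCode.size
  omega

theorem exists_polynomial_size_le : ∃ p : Polynomial ℕ, ∀ l : ℕ,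
    (fibonacciCode (2 * l + 1)).size Nat.size ≤ p.eval l := by
  refine ⟨(2 * Polynomial.X + 1 + 2) + (2 * Polynomial.X + 1 + 1) +
    (2 * Polynomial.X + 1 + 2) ^ 2 * (2 * (2 * Polynomial.X + 1) + 14), fun l => ?_⟩
  simpa using size_fibonacciCode_le (2 * l + 1)

/-! ### Assembly of both time models -/

theorem mainTheorem5 :
    -- continuous time
    (∃ p : Polynomial ℕ, ∀ ℓ : ℕ, ∃ c : NetworkCode ℚ≥0,
      c.size nnratBits ≤ p.eval ℓ ∧
      c.toCont.IsAcyclic ∧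
      c.toCont.contCapacityChanges = 1 ∧
      (∃ S, c.toCont.IsContMinCut S ∧ c.toCont.IsPiecewiseConstantCut S) ∧
      (∃ f, c.toCont.IsContMaxFlow f ∧ c.toCont.IsPiecewiseConstantFlow f) ∧
      (∀ S, c.toCont.IsContMinCut S → c.toCont.IsPiecewiseConstantCut S →
        2 ^ ℓ ≤ c.toCont.contCutComplexity S) ∧
      (∀ f, c.toCont.IsContMaxFlow f → c.toCont.IsPiecewiseConstantFlow f →
        2 ^ ℓ ≤ c.toCont.contFlowComplexity f)) ∧
    -- discrete time
    (∃ p : Polynomial ℕ, ∀ ℓ : ℕ, ∃ c : NetworkCode ℕ,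
      c.size Nat.size ≤ p.eval ℓ ∧
      c.toDisc.IsAcyclic ∧
      c.toDisc.discCapacityChanges = 1 ∧
      (∃ S, c.toDisc.IsDiscMinCut S) ∧
      (∃ f, c.toDisc.IsDiscMaxFlow f) ∧
      (∀ S, c.toDisc.IsDiscMinCut S → 2 ^ ℓ ≤ c.toDisc.discCutComplexity S) ∧
      (∀ f, c.toDisc.IsDiscMaxFlow f → 2 ^ ℓ ≤ c.toDisc.discFlowComplexity f)) := by

  obtain ⟨q, hq⟩ := exists_polynomial_size_le
  have hpow : ∀ l : ℕ, (2 ^ l : ℕ∞) ≤ (Nat.fib (2 * l + 1) : ℕ∞) := fun l => by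
    exact_mod_cast two_pow_le_fib l
  have hpos : ∀ l : ℕ, 0 < 2 * l + 1 := fun l => Nat.succ_pos _
  have hcut : ∀ l : ℕ, ∀ S, (fibonacciNetwork (2 * l + 1)).IsDiscMinCut S →
      2 ^ l ≤ (fibonacciNetwork (2 * l + 1)).discCutComplexity S := fun l S hS =>
    (hpow l).trans (fibonacciNetwork.le_discCutComplexity (hpos l) hS)
  have hflow : ∀ l : ℕ, ∀ f, (fibonacciNetwork (2 * l + 1)).IsDiscMaxFlow f →
      2 ^ l ≤ (fibonacciNetwork (2 * l + 1)).discFlowComplexity f := fun l f hf =>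
    (hpow l).trans (fibonacciNetwork.le_discFlowComplexity (hpos l) hf)
  have hmin : ∀ l : ℕ, (fibonacciNetwork (2 * l + 1)).IsDiscMinCut _ := fun l =>
    fibonacciNetwork.isDiscMinCut_pulseCut (hpos l)
  have hmax : ∀ l : ℕ, (fibonacciNetwork (2 * l + 1)).IsDiscMaxFlow _ := fun l =>
    fibonacciNetwork.isDiscMaxFlow_pulseFlow (hpos l)
  -- The polynomial `2 * q + 2` is the bound of `size_toContCode_le` applied to the discrete size
  -- bound `q`.
  refine ⟨⟨2 * q + 2, fun l => ⟨(fibonacciCode (2 * l + 1)).toContCode, ?_⟩⟩,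
    ⟨q, fun l => ⟨fibonacciCode (2 * l + 1), hq l, fibonacciNetwork.isAcyclic,
      fibonacciNetwork.discCapacityChanges_eq (hpos l), ⟨_, hmin l⟩, ⟨_, hmax l⟩,
      hcut l, hflow l⟩⟩⟩
  have h : (fibonacciNetwork (2 * l + 1)).IsContExtension
      (fibonacciCode (2 * l + 1)).toContCode.toCont :=
    NetworkCode.isContExtension_toContCode _
  refine ⟨?_, fibonacciNetwork.isAcyclic (m := 2 * l + 1), ?_,
    ⟨_, (hmin l).isContMinCut_extendCut h,
      DynamicNetwork.isPiecewiseConstantCut_extendCut _⟩,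
    ⟨_, (hmax l).isContMaxFlow_comp_floor h, fun e _ => ?_⟩,
    fun S hS hpc => DynamicNetwork.le_contCutComplexity h ⟨_, hmin l⟩ (hcut l) hS hpc,
    fun f hf hpc => DynamicNetwork.le_contFlowComplexity h ⟨_, hmax l⟩ (hflow l) hf hpc⟩
  · refine (NetworkCode.size_toContCode_le _).trans ?_
    have := hq l
    simp only [Polynomial.eval_add, Polynomial.eval_mul, Polynomial.eval_ofNat]
    omega
  · exact (DynamicNetwork.contCapacityChanges_eq h).trans
      (fibonacciNetwork.discCapacityChanges_eq (hpos l))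
  · exact isPiecewiseConstant_of_eq_comp_floor fun _ _ _ => rfl
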